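/- Let $0<\varepsilon$ and consider on $(0,1)$ the problem $\varepsilon^2u^{(4)}+L_2u=f$ with $L_2u=-(au')'+bu'+cu$, where $a\in C^1[0,1]$, $b,c\in C[0,1]$, $|a|,|b|,|c|\le M$, and $L_2$ is elliptic on $H^1_0(0,1)$: $\int_0^1(a(v')^2+bv'v+cv^2)\,dx\ge\gamma|v|_1^2$ for all $v\in H_0^1(0,1)$, with $\gamma>0$. Here $|v|_k=\|v^{(k)}\|_{L_2(0,1)}$, and $\|v\|_\varepsilon:=\varepsilon|v|_2+|v|_1$. For $p\in\{1,2\}$, say that $u\in C^4[0,1]$ has layers of order $p$ with constant $K$ if $u=S+E_0+E_1$ with $S,E_0,E_1\in C^4[0,1]$ such that, for $x\in[0,1]$ and $0\le k\le4$, $$|S^{(k)}(x)|\le K,\quad |E_0^{(k)}(x)|\le K\varepsilon^{p-k}e^{-x/\varepsilon},\quad |E_1^{(k)}(x)|\le K\varepsilon^{p-k}e^{-(1-x)/\varepsilon}.$$ For a transition point $0<\tau<1/2$, use a mesh on $[0,1]$ that is equidistant with mesh size $H$ on $[\tau,1-\tau]$ and equidistant with mesh size $h=\alpha H\tau$, $0<\alpha\le\alpha_0$,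 on $[0,\tau]$ and on $[1-\tau,1]$ (so that $0,\tau,1-\tau,1$ are mesh points). Let $V_h$ be the space of cubic $C^1$ splines on this mesh that satisfy the essential boundary conditions, and let the finite element solution $u_h\in V_h$ be defined by $$\int_0^1\big(\varepsilon^2u_h''v''+au_h'v'+bu_h'v+cu_hv\big)dx=\int_0^1fv\,dx\qquad\text{for all }v\in V_h.$$ (i) Boundary conditions $u=u''=0$ at $x=0,1$ (essential conditions in $V_h$: $v(0)=v(1)=0$). Take $\tau=\varepsilon^{1/2}$, so that $h=\alpha\varepsilon^{1/2}H$. There is a constant $C$, depending only on $\gamma,M,K,\alpha_0$, such that, whenever a classical solution $u\in C^4[0,1]$ has layers of order $p=2$ with constant $K$, the finite element solution $u_h$ exists, is unique, and satisfies $$\|u-u_h\|_\varepsilon\le C\big(\varepsilon^{1/2}H^2+H^3\big).$$ (ii) Boundary conditions $u=u'=0$ at $x=0,1$ (essential conditions in $V_h$: $v=v'=0$ at $x=0,1$). Take $\tau=\varepsilon^{3/4}$, so that $h=\alpha\varepsilon^{3/4}H$. There is a constant $C$, depending only on $\gamma,M,K,\alpha_0$, such that, whenever a classical solution $u\in C^4[0,1]$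 has layers of order $p=1$ with constant $K$ (weak layers), the finite element solution $u_h$ exists, is unique, and satisfies $$\|u-u_h\|_\varepsilon\le C H^2 .$$ -/

import Mathlib

open Set MeasureTheory

noncomputable section

namespace LayerFEM

/-- The `k`-th derivative on `[0,1]` (one-sided at the end points). For a function that is `C^1` on
`[0,1]` and piecewise smooth, it is defined except at finitely many points for `k = 2`, where it is
the second weak derivative almost everywhere. -/
def D (k : ℕ) (v : ℝ → ℝ) (t : ℝ) : ℝ := iteratedDerivWithin k v (Icc 0 1) t

/-- The Sobolev seminorm `|v|_k = (∫_0^1 |v^(k)|^2)^(1/2)`. -/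
def seminorm (k : ℕ) (v : ℝ → ℝ) : ℝ := Real.sqrt (∫ t in (0 : ℝ)..1, (D k v t) ^ 2)

/-- The norm `ε |v|_2 + |v|_1`. -/
def epsNorm (ε : ℝ) (v : ℝ → ℝ) : ℝ := ε * seminorm 2 v + seminorm 1 v

/-- The second order operator `L_2 u = -(a u')' + b u' + c u`. -/
def L2 (a b c u : ℝ → ℝ) (t : ℝ) : ℝ :=
  -derivWithin (fun s => a s * D 1 u s) (Icc 0 1) t + b t * D 1 u t + c t * u t

/-- The bilinear form of `ε^2 u'''' + L_2 u`. -/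
def form (ε : ℝ) (a b c u v : ℝ → ℝ) : ℝ :=
  ∫ t in (0 : ℝ)..1, (ε ^ 2 * (D 2 u t * D 2 v t) + a t * D 1 u t * D 1 v t
    + b t * D 1 u t * v t + c t * u t * v t)

/-- `v ∈ H^1_0(0,1)` with weak derivative `g ∈ L^2(0,1)`. -/
structure IsH10 (v g : ℝ → ℝ) : Prop where
  memLp : MemLp g 2 (volume.restrict (Icc (0 : ℝ) 1))
  primitive : ∀ x ∈ Icc (0 : ℝ) 1, v x = ∫ t in (0 : ℝ)..x, g t
  right : v 1 = 0

/-- Ellipticity of `L_2` on `H^1_0(0,1)`: its bilinear form is at least `γ |v|_1^2`. -/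
def IsElliptic (γ : ℝ) (a b c : ℝ → ℝ) : Prop :=
  ∀ v g : ℝ → ℝ, IsH10 v g →
    γ * ∫ t in (0 : ℝ)..1, g t ^ 2 ≤
      ∫ t in (0 : ℝ)..1, (a t * g t * g t + b t * g t * v t + c t * v t * v t)

/-- Regular coefficients, bounded by `M`. -/
structure CoeffBound (M : ℝ) (a b c : ℝ → ℝ) : Prop where
  a_smooth : ContDiffOn ℝ 1 a (Icc 0 1)
  b_cont : ContinuousOn b (Icc 0 1)
  c_cont : ContinuousOn c (Icc 0 1)
  a_le : ∀ t ∈ Icc (0 : ℝ) 1, |a t| ≤ M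
  b_le : ∀ t ∈ Icc (0 : ℝ) 1, |b t| ≤ M
  c_le : ∀ t ∈ Icc (0 : ℝ) 1, |c t| ≤ M

/-- `u` is a classical solution of `ε^2 u'''' + L_2 u = f` in `(0,1)`. -/
structure IsSolution (ε : ℝ) (a b c f u : ℝ → ℝ) : Prop where
  smooth : ContDiffOn ℝ 4 u (Icc 0 1)
  eqn : ∀ t ∈ Ioo (0 : ℝ) 1, ε ^ 2 * D 4 u t + L2 a b c u t = f t

/-- `u = u'' = 0` at both end points. -/
def HingedBC (u : ℝ → ℝ) : Prop := u 0 = 0 ∧ D 2 u 0 = 0 ∧ u 1 = 0 ∧ D 2 u 1 = 0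

/-- `u = u' = 0` at both end points. -/
def ClampedBC (u : ℝ → ℝ) : Prop := u 0 = 0 ∧ D 1 u 0 = 0 ∧ u 1 = 0 ∧ D 1 u 1 = 0

/-- `u = S + E₀ + E₁` with a smooth part `S` and layer parts `E₀` at `x = 0`, `E₁` at `x = 1`:
for `k ≤ 4`, `|S^(k)| ≤ K`, `|E₀^(k)| ≤ K ε^(p-k) e^(-x/ε)` and
`|E₁^(k)| ≤ K ε^(p-k) e^(-(1-x)/ε)`. -/
def HasDecomposition (p : ℕ) (ε K : ℝ) (u : ℝ → ℝ) : Prop :=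
  ∃ S E₀ E₁ : ℝ → ℝ,
    ContDiffOn ℝ 4 S (Icc 0 1) ∧ ContDiffOn ℝ 4 E₀ (Icc 0 1) ∧ ContDiffOn ℝ 4 E₁ (Icc 0 1) ∧
    (∀ t ∈ Icc (0 : ℝ) 1, u t = S t + E₀ t + E₁ t) ∧
    ∀ k : ℕ, k ≤ 4 → ∀ t ∈ Icc (0 : ℝ) 1,
      |D k S t| ≤ K ∧
      |D k E₀ t| ≤ K * ε ^ ((p : ℤ) - (k : ℤ)) * Real.exp (-t / ε) ∧
      |D k E₁ t| ≤ K * ε ^ ((p : ℤ) - (k : ℤ)) * Real.exp (-(1 - t) / ε)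

/-- The data of a mesh on `[0,1]` which is equidistant with `n` cells of size `h = α H τ` on each of
`[0,τ]` and `[1-τ,1]`, and equidistant with `N` cells of size `H` on `[τ,1-τ]`. -/
structure IsLayerMesh (τ α H : ℝ) (n N : ℕ) : Prop where
  tau_pos : 0 < τ
  tau_lt : τ < 1 / 2
  fine : n * (α * H * τ) = τ
  coarse : N * H = 1 - 2 * τ

/-- The points `x_0 < x_1 < ... < x_(2n+N)` of that mesh. -/
def meshPoint (τ α H : ℝ) (n N i : ℕ) : ℝ :=
  if i ≤ n then (i : ℝ) * (α * H * τ)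
  else if i ≤ n + N then τ + ((i : ℝ) - n) * H
  else 1 - τ + ((i : ℝ) - n - N) * (α * H * τ)

/-- Cubic `C^1` splines on the mesh. -/
structure IsSpline (τ α H : ℝ) (n N : ℕ) (v : ℝ → ℝ) : Prop where
  smooth : ContDiffOn ℝ 1 v (Icc 0 1)
  cubic : ∀ i < 2 * n + N, ∃ q : Polynomial ℝ, q.natDegree ≤ 3 ∧
    ∀ t ∈ Icc (meshPoint τ α H n N i) (meshPoint τ α H n N (i + 1)), v t = q.eval t

/-- Conforming space for `u = u'' = 0`: only `v = 0` at the end points is essential, the condition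
on the second derivative is natural. -/
def hingedSpace (τ α H : ℝ) (n N : ℕ) : Set (ℝ → ℝ) :=
  {v | IsSpline τ α H n N v ∧ v 0 = 0 ∧ v 1 = 0}

/-- Conforming space for `u = u' = 0`. -/
def clampedSpace (τ α H : ℝ) (n N : ℕ) : Set (ℝ → ℝ) :=
  {v | IsSpline τ α H n N v ∧ ClampedBC v}

/-- `w` is a finite element (Galerkin) solution in the space `V`. -/
def IsGalerkin (ε : ℝ) (a b c f : ℝ → ℝ) (V : Set (ℝ → ℝ)) (w : ℝ → ℝ) : Prop :=
  w ∈ V ∧ ∀ v ∈ V, form ε a b c w v = ∫ t in (0 : ℝ)..1, f t * v t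

/-- The finite element problem has a solution, unique as a function on `[0,1]`, and its error to `u`
is at most `B` in the norm `ε |·|_2 + |·|_1`. -/
def GalerkinErrorLE (ε : ℝ) (a b c f u : ℝ → ℝ) (V : Set (ℝ → ℝ)) (B : ℝ) : Prop :=
  ∃ w : ℝ → ℝ, IsGalerkin ε a b c f V w ∧
    (∀ w' : ℝ → ℝ, IsGalerkin ε a b c f V w' → EqOn w' w (Icc 0 1)) ∧
    epsNorm ε (fun t => u t - w t) ≤ B

end LayerFEM

end

namespace LayerFEM

/-! ### Derivatives on the unit interval -/

/-! The proof combines Céa's lemma with cubic Hermite interpolation. Ellipticity makes the bilinear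
form control `ε²|v|₂² + γ|v|₁²`. Young's inequality and Poincaré bound the form in the same
quantities, so the Galerkin error is at most a constant depending on `γ` and `M` times the
interpolation error (`cea`, `IsSplineSpace.galerkinErrorLE`). Integration by parts puts the
classical solution into the weak equation: the boundary terms `u''v'` vanish because `u'' = 0` in
the hinged case and `v' = 0` in the clamped one (`IsSolution.weak`).

Let `z` be the interpolation error on a cell of length `ℓ`. Both `z` and `z'` vanish at the end
points, so integration by parts gives `‖z''‖ ≤ ℓ²‖u''''‖` and `‖z''‖ ≤ ℓ‖u'''‖`, and Poincaré gives
`‖z'‖ ≤ ℓ‖z''‖` (`hermite_cell_error`). It then suffices to bound the weighted squares of `u''''` or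
`u'''` pointwise by `B (1 + ε⁻¹ layer)`, because the squared layers integrate to at most `ε`
(`integral_layer_le`).

On coarse cells `τ/ε` is a negative power of `ε`, so the layers are smaller than any power of `ε`.
On fine cells the choice of `τ` balances the powers. For `p = 2`, `h = αHε^{1/2}`, the layer weights
`ε²h⁴ε⁻⁴` and `h⁶ε⁻⁴` equal `α⁴(εH⁴)ε⁻¹` and `α⁶H⁶ε⁻¹`. For `p = 1`, `h = αHε^{3/4}`, both `ε²h⁴ε⁻⁶`
(from `u''''`) and `h⁴ε⁻⁴` (from `u'''`) equal `α⁴H⁴ε⁻¹`. Estimating `|z|₁` through `u''''` would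
there give `h⁶ε⁻⁶`, of order `H⁶ε^{-3/2}`, which is too large; hence the third-derivative bound. -/

lemma uniqueDiffOn_unit : UniqueDiffOn ℝ (Icc (0 : ℝ) 1) := uniqueDiffOn_Icc zero_lt_one

lemma D_zero (v : ℝ → ℝ) : D 0 v = v := by
  funext t; simp [D]

lemma D_succ (k : ℕ) (v : ℝ → ℝ) : D (k + 1) v = derivWithin (D k v) (Icc 0 1) := by
  funext t; simp only [D, iteratedDerivWithin_succ]; rfl

lemma D_congr (k : ℕ) {v w : ℝ → ℝ} (h : EqOn v w (Icc 0 1)) : EqOn (D k v) (D k w) (Icc 0 1) :=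
  iteratedDerivWithin_congr h

lemma hasDerivWithinAt_D {v : ℝ → ℝ} {n k : ℕ} (h : ContDiffOn ℝ n v (Icc 0 1)) (hk : k < n)
    {t : ℝ} (ht : t ∈ Icc (0 : ℝ) 1) : HasDerivWithinAt (D k v) (D (k + 1) v t) (Icc 0 1) t := by
  rw [D_succ]
  exact (h.differentiableOn_iteratedDerivWithin (by exact_mod_cast hk)
    uniqueDiffOn_unit t ht).hasDerivWithinAt

lemma hasDerivAt_D {v : ℝ → ℝ} {n k : ℕ} (h : ContDiffOn ℝ n v (Icc 0 1)) (hk : k < n)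
    {t : ℝ} (ht : t ∈ Ioo (0 : ℝ) 1) : HasDerivAt (D k v) (D (k + 1) v t) t :=
  (hasDerivWithinAt_D h hk (Ioo_subset_Icc_self ht)).hasDerivAt (Icc_mem_nhds ht.1 ht.2)

lemma continuousOn_D {v : ℝ → ℝ} {n k : ℕ} (h : ContDiffOn ℝ n v (Icc 0 1)) (hk : k ≤ n) :
    ContinuousOn (D k v) (Icc 0 1) :=
  h.continuousOn_iteratedDerivWithin (by exact_mod_cast hk) uniqueDiffOn_unit

lemma D_one_of_hasDerivWithinAt {v : ℝ → ℝ} {v' t : ℝ} (ht : t ∈ Icc (0 : ℝ) 1)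
    (h : HasDerivWithinAt v v' (Icc 0 1) t) : D 1 v t = v' := by
  rw [D_succ 0, D_zero]
  exact h.derivWithin (uniqueDiffOn_unit t ht)

lemma D_two_of_hasDerivAt {v : ℝ → ℝ} {v' t : ℝ} (ht : t ∈ Ioo (0 : ℝ) 1)
    (h : HasDerivAt (D 1 v) v' t) : D 2 v t = v' := by
  rw [D_succ 1]
  exact h.hasDerivWithinAt.derivWithin (uniqueDiffOn_unit t (Ioo_subset_Icc_self ht))

/-- Lebesgue measure on the unit interval. -/
noncomputable abbrev unitMeasure : Measure ℝ := volume.restrict (Ioc (0 : ℝ) 1)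

lemma ae_unit_of_countable {s : Set ℝ} (hs : s.Countable) :
    ∀ᵐ t ∂unitMeasure, t ∈ Ioo (0 : ℝ) 1 \ s := by
  have h1 : ∀ᵐ t : ℝ, t ∉ s := by
    simpa [ae_iff] using hs.measure_zero volume
  have h2 : ∀ᵐ t : ℝ, t ≠ 1 := volume.ae_ne 1
  filter_upwards [ae_restrict_mem measurableSet_Ioc, ae_restrict_of_ae h1, ae_restrict_of_ae h2]
    with t ht h3 h4
  exact ⟨⟨ht.1, lt_of_le_of_ne ht.2 h4⟩, h3⟩

lemma memLp_of_continuousOn {g : ℝ → ℝ} (hg : ContinuousOn g (Icc 0 1)) :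
    MemLp g ⊤ unitMeasure := by
  obtain ⟨B, hB⟩ := isCompact_Icc.exists_bound_of_continuousOn hg
  refine memLp_top_of_bound
    ((hg.mono Ioc_subset_Icc_self).aestronglyMeasurable measurableSet_Ioc) B ?_
  filter_upwards [ae_restrict_mem measurableSet_Ioc] with t ht
  exact hB t (Ioc_subset_Icc_self ht)

/-- Essential boundedness is stable under products, unlike square integrability, and implies
integrability on a finite measure. Working in `L^∞` therefore settles the integrability of the
products in the bilinear form. -/
lemma memLp_mul {f g : ℝ → ℝ} (hf : MemLp f ⊤ unitMeasure) (hg : MemLp g ⊤ unitMeasure) :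
    MemLp (fun t => f t * g t) ⊤ unitMeasure := hg.mul (r := ⊤) hf

lemma integrable_of_memLp {f : ℝ → ℝ} (hf : MemLp f ⊤ unitMeasure) : Integrable f unitMeasure :=
  hf.integrable le_top

lemma integral_unit (f : ℝ → ℝ) : ∫ t in (0 : ℝ)..1, f t = ∫ t, f t ∂unitMeasure :=
  intervalIntegral.integral_of_le zero_le_one

/-! ### Functions with a bounded second derivative off a countable set -/

/-- `v` is `C^1` on `[0,1]`, and `v'` is differentiable off a countable set with bounded
derivative. -/
structure IsH2 (v : ℝ → ℝ) : Prop where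
  smooth : ContDiffOn ℝ 1 v (Icc 0 1)
  diff : ∃ s : Set ℝ, s.Countable ∧ ∀ t ∈ Ioo (0 : ℝ) 1 \ s, HasDerivAt (D 1 v) (D 2 v t) t
  bdd : MemLp (D 2 v) ⊤ unitMeasure

namespace IsH2

variable {u v w : ℝ → ℝ}

lemma hasDerivWithinAt (hv : IsH2 v) {t : ℝ} (ht : t ∈ Icc (0 : ℝ) 1) :
    HasDerivWithinAt v (D 1 v t) (Icc 0 1) t := by
  simpa [D_zero] using hasDerivWithinAt_D (n := 1) (k := 0) (by exact_mod_cast hv.smooth)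
    zero_lt_one ht

lemma hasDerivAt (hv : IsH2 v) {t : ℝ} (ht : t ∈ Ioo (0 : ℝ) 1) : HasDerivAt v (D 1 v t) t :=
  (hv.hasDerivWithinAt (Ioo_subset_Icc_self ht)).hasDerivAt (Icc_mem_nhds ht.1 ht.2)

lemma continuousOn (hv : IsH2 v) : ContinuousOn v (Icc 0 1) := hv.smooth.continuousOn

lemma continuousOn_D_one (hv : IsH2 v) : ContinuousOn (D 1 v) (Icc 0 1) :=
  continuousOn_D (n := 1) (by exact_mod_cast hv.smooth) le_rfl

lemma memLp (hv : IsH2 v) : MemLp v ⊤ unitMeasure := memLp_of_continuousOn hv.continuousOn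

lemma memLp_D_one (hv : IsH2 v) : MemLp (D 1 v) ⊤ unitMeasure :=
  memLp_of_continuousOn hv.continuousOn_D_one

lemma D_one_lincomb (hu : IsH2 u) (hv : IsH2 v) (r s : ℝ) {t : ℝ} (ht : t ∈ Icc (0 : ℝ) 1) :
    D 1 (fun x => r * u x + s * v x) t = r * D 1 u t + s * D 1 v t :=
  D_one_of_hasDerivWithinAt ht
    (((hu.hasDerivWithinAt ht).const_mul r).add ((hv.hasDerivWithinAt ht).const_mul s))

lemma hasDerivAt_D_one_lincomb (hu : IsH2 u) (hv : IsH2 v) (r s : ℝ) {t : ℝ}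
    (ht : t ∈ Ioo (0 : ℝ) 1) (h1 : HasDerivAt (D 1 u) (D 2 u t) t)
    (h2 : HasDerivAt (D 1 v) (D 2 v t) t) :
    HasDerivAt (D 1 (fun x => r * u x + s * v x)) (r * D 2 u t + s * D 2 v t) t := by
  refine ((h1.const_mul r).add (h2.const_mul s)).congr_of_eventuallyEq ?_
  filter_upwards [Icc_mem_nhds ht.1 ht.2] with x hx
  exact D_one_lincomb hu hv r s hx

/-- Only almost everywhere: at a mesh node a spline need not have a second derivative, and the value
of `D 2` there carries no information. -/
lemma D_two_lincomb (hu : IsH2 u) (hv : IsH2 v) (r s : ℝ) :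
    D 2 (fun x => r * u x + s * v x) =ᵐ[unitMeasure] fun t => r * D 2 u t + s * D 2 v t := by
  obtain ⟨p, hp, hp'⟩ := hu.diff
  obtain ⟨q, hq, hq'⟩ := hv.diff
  filter_upwards [ae_unit_of_countable hp, ae_unit_of_countable hq] with t ht1 ht2
  exact D_two_of_hasDerivAt ht1.1
    (hasDerivAt_D_one_lincomb hu hv r s ht1.1 (hp' t ht1) (hq' t ht2))

lemma lincomb (hu : IsH2 u) (hv : IsH2 v) (r s : ℝ) : IsH2 (fun x => r * u x + s * v x) where
  smooth := (contDiffOn_const.mul hu.smooth).add (contDiffOn_const.mul hv.smooth)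
  diff := by
    obtain ⟨p, hp, hp'⟩ := hu.diff
    obtain ⟨q, hq, hq'⟩ := hv.diff
    refine ⟨p ∪ q, hp.union hq, fun t ht => ?_⟩
    have h := hasDerivAt_D_one_lincomb hu hv r s ht.1
      (hp' t ⟨ht.1, fun h => ht.2 (Or.inl h)⟩) (hq' t ⟨ht.1, fun h => ht.2 (Or.inr h)⟩)
    rwa [D_two_of_hasDerivAt ht.1 h]
  bdd := by
    refine MemLp.ae_eq (D_two_lincomb hu hv r s).symm ?_
    exact (hu.bdd.const_mul r).add (hv.bdd.const_mul s)

lemma sub (hu : IsH2 u) (hv : IsH2 v) : IsH2 (fun x => u x - v x) := by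
  simpa [sub_eq_add_neg] using hu.lincomb hv 1 (-1)

lemma of_contDiffOn {n : ℕ} (hn : 2 ≤ n) (hu : ContDiffOn ℝ n u (Icc 0 1)) : IsH2 u where
  smooth := hu.of_le (by exact_mod_cast (by omega : 1 ≤ n))
  diff := ⟨∅, countable_empty, fun _ ht => hasDerivAt_D hu (by omega) ht.1⟩
  bdd := memLp_of_continuousOn (continuousOn_D hu hn)

/-- A bound on the second derivative gives its measurability for free. -/
lemma of_bound (hv : ContDiffOn ℝ 1 v (Icc 0 1)) {s : Set ℝ} (hs : s.Countable) {B : ℝ}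
    (h : ∀ t ∈ Ioo (0 : ℝ) 1 \ s, ∃ y, |y| ≤ B ∧ HasDerivAt (D 1 v) y t) : IsH2 v where
  smooth := hv
  diff := by
    refine ⟨s, hs, fun t ht => ?_⟩
    obtain ⟨y, -, hy⟩ := h t ht
    rwa [D_two_of_hasDerivAt ht.1 hy]
  bdd := by
    -- `deriv` of any real function is measurable, and it agrees with `D 2 v` off the exceptional
    -- set.
    have h1 : deriv (D 1 v) =ᵐ[unitMeasure] D 2 v := by
      filter_upwards [ae_unit_of_countable hs] with t ht
      obtain ⟨y, -, hy⟩ := h t ht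
      rw [D_two_of_hasDerivAt ht.1 hy, hy.deriv]
    refine memLp_top_of_bound ((measurable_deriv _).aestronglyMeasurable.congr h1) B ?_
    filter_upwards [ae_unit_of_countable hs] with t ht
    obtain ⟨y, hB, hy⟩ := h t ht
    rwa [D_two_of_hasDerivAt ht.1 hy]

lemma integrable_sq_D_two (hu : IsH2 u) : Integrable (fun t => D 2 u t ^ 2) unitMeasure := by
  simpa [pow_two] using integrable_of_memLp (memLp_mul hu.bdd hu.bdd)

lemma integrable_sq_D_one (hu : IsH2 u) : Integrable (fun t => D 1 u t ^ 2) unitMeasure := by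
  simpa [pow_two] using integrable_of_memLp (memLp_mul hu.memLp_D_one hu.memLp_D_one)

lemma integrable_sq (hu : IsH2 u) : Integrable (fun t => u t ^ 2) unitMeasure := by
  simpa [pow_two] using integrable_of_memLp (memLp_mul hu.memLp hu.memLp)

end IsH2

/-- Cauchy–Schwarz against the constant `1`, obtained by integrating `((b - a) g - I)² ≥ 0`, where
`I` is the integral of `g`. -/
lemma sq_integral_le {a b : ℝ} (hab : a ≤ b) {g : ℝ → ℝ} (h1 : IntervalIntegrable g volume a b)
    (h2 : IntervalIntegrable (fun t => g t ^ 2) volume a b) :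
    (∫ t in a..b, g t) ^ 2 ≤ (b - a) * ∫ t in a..b, g t ^ 2 := by
  rcases hab.eq_or_lt with rfl | hlt
  · simp
  have hd : 0 < b - a := sub_pos.2 hlt
  set I := ∫ t in a..b, g t with hI
  have h0 : 0 ≤ ∫ t in a..b, ((b - a) ^ 2 * g t ^ 2 + (-(2 * (b - a) * I)) * g t + I ^ 2) := by
    refine intervalIntegral.integral_nonneg hab fun t _ => ?_
    nlinarith [sq_nonneg ((b - a) * g t - I)]
  rw [intervalIntegral.integral_add ((h2.const_mul _).add (h1.const_mul _)) (by simp),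
    intervalIntegral.integral_add (h2.const_mul _) (h1.const_mul _),
    intervalIntegral.integral_const_mul, intervalIntegral.integral_const_mul, ← hI,
    intervalIntegral.integral_const, smul_eq_mul] at h0
  have : 0 ≤ (b - a) * ((b - a) * (∫ t in a..b, g t ^ 2) - I ^ 2) := by linarith
  linarith [nonneg_of_mul_nonneg_right this hd]

/-- A function vanishing at the left end point is controlled by its derivative. -/
lemma sq_le_of_eq_zero_left {a b : ℝ} {z z' : ℝ → ℝ} (hz : ContinuousOn z (Icc a b))
    (hz' : ContinuousOn z' (Icc a b)) (hd : ∀ t ∈ Ioo a b, HasDerivAt z (z' t) t)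
    (ha : z a = 0) {t : ℝ} (ht : t ∈ Icc a b) :
    z t ^ 2 ≤ (b - a) * ∫ x in a..b, z' x ^ 2 := by
  have hsub : Icc a t ⊆ Icc a b := Icc_subset_Icc_right ht.2
  have hab : a ≤ b := ht.1.trans ht.2
  have hsq : IntervalIntegrable (fun x => z' x ^ 2) volume a b :=
    (hz'.pow 2).intervalIntegrable_of_Icc hab
  have hsq' : IntervalIntegrable (fun x => z' x ^ 2) volume a t :=
    ((hz'.mono hsub).pow 2).intervalIntegrable_of_Icc ht.1
  have hint : IntervalIntegrable z' volume a t := (hz'.mono hsub).intervalIntegrable_of_Icc ht.1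
  have hftc := intervalIntegral.integral_eq_sub_of_hasDerivAt_of_le ht.1 (hz.mono hsub)
    (fun x hx => hd x ⟨hx.1, hx.2.trans_le ht.2⟩) hint
  rw [ha, sub_zero] at hftc
  rw [← hftc]
  have hmono : ∫ x in a..t, z' x ^ 2 ≤ ∫ x in a..b, z' x ^ 2 :=
    intervalIntegral.integral_mono_interval le_rfl ht.1 ht.2
      (Filter.Eventually.of_forall fun x => sq_nonneg (z' x)) hsq
  calc _ ≤ (t - a) * ∫ x in a..t, z' x ^ 2 := sq_integral_le ht.1 hint hsq'
    _ ≤ _ := mul_le_mul (by linarith [ht.2]) hmono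
      (intervalIntegral.integral_nonneg ht.1 fun x _ => sq_nonneg _) (by linarith)

lemma integral_sq_le_of_eq_zero_left {a b : ℝ} (hab : a ≤ b) {z z' : ℝ → ℝ}
    (hz : ContinuousOn z (Icc a b))
    (hz' : ContinuousOn z' (Icc a b)) (hd : ∀ t ∈ Ioo a b, HasDerivAt z (z' t) t)
    (ha : z a = 0) :
    ∫ t in a..b, z t ^ 2 ≤ (b - a) ^ 2 * ∫ t in a..b, z' t ^ 2 := by
  have h := intervalIntegral.integral_mono_on hab ((hz.pow 2).intervalIntegrable_of_Icc hab)
    (_root_.intervalIntegrable_const (μ := volume)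
      (c := (b - a) * ∫ x in a..b, z' x ^ 2))
    fun t ht => sq_le_of_eq_zero_left hz hz' hd ha ht
  rw [intervalIntegral.integral_const, smul_eq_mul] at h
  simp only [Pi.pow_apply] at h
  linarith

namespace IsH2

variable {u v w : ℝ → ℝ}

lemma sq_le (hv : IsH2 v) (h0 : v 0 = 0) {t : ℝ} (ht : t ∈ Icc (0 : ℝ) 1) :
    v t ^ 2 ≤ ∫ x in (0 : ℝ)..1, D 1 v x ^ 2 := by
  simpa using sq_le_of_eq_zero_left hv.continuousOn hv.continuousOn_D_one
    (fun t ht => hv.hasDerivAt ht) h0 ht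

lemma integral_sq_le (hv : IsH2 v) (h0 : v 0 = 0) :
    ∫ x in (0 : ℝ)..1, v x ^ 2 ≤ ∫ x in (0 : ℝ)..1, D 1 v x ^ 2 := by
  simpa using integral_sq_le_of_eq_zero_left zero_le_one hv.continuousOn hv.continuousOn_D_one
    (fun t ht => hv.hasDerivAt ht) h0

lemma isH10 (hv : IsH2 v) (h0 : v 0 = 0) (h1 : v 1 = 0) : IsH10 v (D 1 v) where
  memLp := by
    rw [← Measure.restrict_congr_set Ioc_ae_eq_Icc]
    exact hv.memLp_D_one.mono_exponent le_top
  primitive := fun x hx => by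
    have hsub : Icc 0 x ⊆ Icc (0 : ℝ) 1 := Icc_subset_Icc_right hx.2
    rw [intervalIntegral.integral_eq_sub_of_hasDerivAt_of_le hx.1 (hv.continuousOn.mono hsub)
      (fun t ht => hv.hasDerivAt ⟨ht.1, ht.2.trans_le hx.2⟩)
      ((hv.continuousOn_D_one.mono hsub).intervalIntegrable_of_Icc hx.1), h0, sub_zero]
  right := h1

end IsH2

/-! ### The bilinear form -/

section Form

variable {ε γ M : ℝ} {a b c f u v w : ℝ → ℝ}

lemma CoeffBound.memLp (hc : CoeffBound M a b c) :
    MemLp a ⊤ unitMeasure ∧ MemLp b ⊤ unitMeasure ∧ MemLp c ⊤ unitMeasure :=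
  ⟨memLp_of_continuousOn hc.a_smooth.continuousOn, memLp_of_continuousOn hc.b_cont,
    memLp_of_continuousOn hc.c_cont⟩

lemma memLp_form (hc : CoeffBound M a b c) (hu : IsH2 u) (hv : IsH2 v) (ε : ℝ) :
    MemLp (fun t => ε ^ 2 * (D 2 u t * D 2 v t) + a t * D 1 u t * D 1 v t
      + b t * D 1 u t * v t + c t * u t * v t) ⊤ unitMeasure := by
  obtain ⟨ha, hb, hcc⟩ := hc.memLp
  exact ((((memLp_mul hu.bdd hv.bdd).const_mul _).add
    (memLp_mul (memLp_mul ha hu.memLp_D_one) hv.memLp_D_one)).add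
    (memLp_mul (memLp_mul hb hu.memLp_D_one) hv.memLp)).add
    (memLp_mul (memLp_mul hcc hu.memLp) hv.memLp)

lemma form_congr {u' v' : ℝ → ℝ} (hu : EqOn u u' (Icc 0 1)) (hv : EqOn v v' (Icc 0 1)) :
    form ε a b c u v = form ε a b c u' v' := by
  refine intervalIntegral.integral_congr fun t ht => ?_
  rw [uIcc_of_le zero_le_one] at ht
  simp only [D_congr 1 hu ht, D_congr 2 hu ht, D_congr 1 hv ht, D_congr 2 hv ht, hu ht, hv ht]

lemma form_lincomb_left (hc : CoeffBound M a b c) (hu : IsH2 u) (hv : IsH2 v) (hw : IsH2 w)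
    (r s : ℝ) : form ε a b c (fun t => r * u t + s * v t) w
      = r * form ε a b c u w + s * form ε a b c v w := by
  simp only [form, integral_unit]
  rw [← integral_const_mul, ← integral_const_mul,
    ← integral_add ((integrable_of_memLp (memLp_form hc hu hw ε)).const_mul r)
      ((integrable_of_memLp (memLp_form hc hv hw ε)).const_mul s)]
  refine integral_congr_ae ?_
  filter_upwards [ae_restrict_mem measurableSet_Ioc, hu.D_two_lincomb hv r s] with t ht h2
  rw [h2, hu.D_one_lincomb hv r s (Ioc_subset_Icc_self ht)]
  ring

lemma form_lincomb_right (hc : CoeffBound M a b c) (hu : IsH2 u) (hv : IsH2 v) (hw : IsH2 w)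
    (r s : ℝ) : form ε a b c w (fun t => r * u t + s * v t)
      = r * form ε a b c w u + s * form ε a b c w v := by
  simp only [form, integral_unit]
  rw [← integral_const_mul, ← integral_const_mul,
    ← integral_add ((integrable_of_memLp (memLp_form hc hw hu ε)).const_mul r)
      ((integrable_of_memLp (memLp_form hc hw hv ε)).const_mul s)]
  refine integral_congr_ae ?_
  filter_upwards [ae_restrict_mem measurableSet_Ioc, hu.D_two_lincomb hv r s] with t ht h2
  rw [h2, hu.D_one_lincomb hv r s (Ioc_subset_Icc_self ht)]
  ring

/-- The fourth-order term contributes exactly `ε²|v|₂²`; the rest is the form in the ellipticity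
hypothesis, applied with the classical derivative as weak derivative. -/
lemma form_coercive (hc : CoeffBound M a b c) (hell : IsElliptic γ a b c) (hv : IsH2 v)
    (h0 : v 0 = 0) (h1 : v 1 = 0) :
    ε ^ 2 * (∫ t in (0 : ℝ)..1, D 2 v t ^ 2) + γ * ∫ t in (0 : ℝ)..1, D 1 v t ^ 2
      ≤ form ε a b c v v := by
  obtain ⟨ha, hb, hcc⟩ := hc.memLp
  have h := hell v (D 1 v) (hv.isH10 h0 h1)
  have hint : Integrable (fun t => a t * D 1 v t * D 1 v t
      + b t * D 1 v t * v t + c t * v t * v t) unitMeasure :=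
    integrable_of_memLp (((memLp_mul (memLp_mul ha hv.memLp_D_one) hv.memLp_D_one).add
      (memLp_mul (memLp_mul hb hv.memLp_D_one) hv.memLp)).add
      (memLp_mul (memLp_mul hcc hv.memLp) hv.memLp))
  have h2 : form ε a b c v v = ε ^ 2 * (∫ t in (0 : ℝ)..1, D 2 v t ^ 2)
      + ∫ t in (0 : ℝ)..1, (a t * D 1 v t * D 1 v t + b t * D 1 v t * v t + c t * v t * v t) := by
    simp only [form, integral_unit]
    rw [← integral_const_mul, ← integral_add (hv.integrable_sq_D_two.const_mul _) hint]
    congr 1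
    funext t
    ring
  linarith

lemma mul_le_add_sq {δ x y : ℝ} (hδ : 0 < δ) (k : ℝ) :
    k * x * y ≤ δ * x ^ 2 + k ^ 2 / (4 * δ) * y ^ 2 := by
  have h : 0 ≤ (2 * δ * x - k * y) ^ 2 / (4 * δ) := by positivity
  have h' : (2 * δ * x - k * y) ^ 2 / (4 * δ)
      = δ * x ^ 2 + k ^ 2 / (4 * δ) * y ^ 2 - k * x * y := by
    field_simp
    ring
  linarith

lemma mul_le_of_abs_le {δ x y k M : ℝ} (hδ : 0 < δ) (hk : |k| ≤ M) :
    k * x * y ≤ δ * x ^ 2 + M ^ 2 / (4 * δ) * y ^ 2 := by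
  refine (mul_le_add_sq hδ k).trans ?_
  have : k ^ 2 ≤ M ^ 2 := sq_le_sq' (by linarith [(abs_le.1 hk).1]) (abs_le.1 hk).2
  gcongr

/-- The coefficients of the `u` terms are half of those in `form_coercive`, so that in `cea` these
terms can be absorbed on the left. -/
lemma form_le (hγ : 0 < γ) (hc : CoeffBound M a b c) (hu : IsH2 u) (hv : IsH2 v)
    (hu0 : u 0 = 0) (hv0 : v 0 = 0) :
    form ε a b c u v ≤ ε ^ 2 / 2 * (∫ t in (0 : ℝ)..1, D 2 u t ^ 2)
      + ε ^ 2 / 2 * (∫ t in (0 : ℝ)..1, D 2 v t ^ 2)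
      + γ / 2 * (∫ t in (0 : ℝ)..1, D 1 u t ^ 2)
      + 6 * M ^ 2 / γ * ∫ t in (0 : ℝ)..1, D 1 v t ^ 2 := by
  have hpu := hu.integral_sq_le hu0
  have hpv := hv.integral_sq_le hv0
  have i1 := hu.integrable_sq_D_two.const_mul (ε ^ 2 / 2)
  have i2 := hv.integrable_sq_D_two.const_mul (ε ^ 2 / 2)
  have i3 := hu.integrable_sq_D_one.const_mul (γ / 4)
  have i4 := hv.integrable_sq_D_one.const_mul (2 * M ^ 2 / γ)
  have i5 := hu.integrable_sq.const_mul (γ / 8)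
  have i6 := hv.integrable_sq.const_mul (4 * M ^ 2 / γ)
  have key : form ε a b c u v ≤ ∫ t, (ε ^ 2 / 2 * D 2 u t ^ 2 + ε ^ 2 / 2 * D 2 v t ^ 2
      + γ / 4 * D 1 u t ^ 2 + 2 * M ^ 2 / γ * D 1 v t ^ 2 + γ / 8 * u t ^ 2
      + 4 * M ^ 2 / γ * v t ^ 2) ∂unitMeasure := by
    simp only [form, integral_unit]
    refine integral_mono_ae (integrable_of_memLp (memLp_form hc hu hv ε))
      (((((i1.add i2).add i3).add i4).add i5).add i6) ?_
    filter_upwards [ae_restrict_mem measurableSet_Ioc] with t ht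
    have ht' := Ioc_subset_Icc_self ht
    -- With weight `γ / 8` in each of the three lower-order products, the `u` terms stay below `γ /
    -- 2` after Poincaré, and each `v` term costs `2 M² / γ`.
    have hδ : (0 : ℝ) < γ / 8 := by positivity
    have e1 := mul_le_of_abs_le (x := D 1 u t) (y := D 1 v t) hδ (hc.a_le t ht')
    have e2 := mul_le_of_abs_le (x := D 1 u t) (y := v t) hδ (hc.b_le t ht')
    have e3 := mul_le_of_abs_le (x := u t) (y := v t) hδ (hc.c_le t ht')
    have e4 : ε ^ 2 * (D 2 u t * D 2 v t) ≤ ε ^ 2 / 2 * D 2 u t ^ 2 + ε ^ 2 / 2 * D 2 v t ^ 2 := by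
      nlinarith [mul_nonneg (sq_nonneg ε) (sq_nonneg (D 2 u t - D 2 v t))]
    have e5 : M ^ 2 / (4 * (γ / 8)) = 2 * M ^ 2 / γ := by field_simp; ring
    rw [e5] at e1 e2 e3
    have e6 : 4 * M ^ 2 / γ = 2 * M ^ 2 / γ + 2 * M ^ 2 / γ := by ring
    rw [e6]
    linarith
  rw [integral_add (by exact (((i1.add i2).add i3).add i4).add i5) i6,
    integral_add (by exact ((i1.add i2).add i3).add i4) i5,
    integral_add (by exact (i1.add i2).add i3) i4,
    integral_add (by exact i1.add i2) i3, integral_add i1 i2] at key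
  simp only [integral_const_mul, ← integral_unit] at key
  have m1 : γ / 8 * (∫ t in (0 : ℝ)..1, u t ^ 2) ≤ γ / 4 * ∫ t in (0 : ℝ)..1, D 1 u t ^ 2 := by
    have : 0 ≤ ∫ t in (0 : ℝ)..1, D 1 u t ^ 2 :=
      intervalIntegral.integral_nonneg zero_le_one fun _ _ => sq_nonneg _
    nlinarith
  have m2 : 4 * M ^ 2 / γ * (∫ t in (0 : ℝ)..1, v t ^ 2)
      ≤ 4 * M ^ 2 / γ * ∫ t in (0 : ℝ)..1, D 1 v t ^ 2 := by gcongr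
  have e7 : 6 * M ^ 2 / γ = 2 * M ^ 2 / γ + 4 * M ^ 2 / γ := by ring
  rw [e7]
  linarith

/-- Quasi-optimality: if `e` is orthogonal to `e - z`, then `e` is bounded by `z`. -/
lemma cea (hγ : 0 < γ) (hc : CoeffBound M a b c) (hell : IsElliptic γ a b c) {e z : ℝ → ℝ}
    (he : IsH2 e) (hz : IsH2 z) (he0 : e 0 = 0) (he1 : e 1 = 0) (hz0 : z 0 = 0)
    (horth : form ε a b c e e = form ε a b c e z) :
    ε ^ 2 * (∫ t in (0 : ℝ)..1, D 2 e t ^ 2) + γ * ∫ t in (0 : ℝ)..1, D 1 e t ^ 2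
      ≤ ε ^ 2 * (∫ t in (0 : ℝ)..1, D 2 z t ^ 2)
        + 12 * M ^ 2 / γ * ∫ t in (0 : ℝ)..1, D 1 z t ^ 2 := by
  have h1 := form_coercive (ε := ε) hc hell he he0 he1
  have h2 := form_le (ε := ε) hγ hc he hz he0 hz0
  have e7 : 12 * M ^ 2 / γ = 2 * (6 * M ^ 2 / γ) := by ring
  rw [e7]
  linarith

lemma eq_zero_of_form_self_eq_zero (hγ : 0 < γ) (hc : CoeffBound M a b c)
    (hell : IsElliptic γ a b c) (hv : IsH2 v) (h0 : v 0 = 0) (h1 : v 1 = 0)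
    (hform : form ε a b c v v = 0) : ∀ t ∈ Icc (0 : ℝ) 1, v t = 0 := by
  intro t ht
  have h := form_coercive (ε := ε) hc hell hv h0 h1
  have h2 : 0 ≤ ∫ t in (0 : ℝ)..1, D 2 v t ^ 2 :=
    intervalIntegral.integral_nonneg zero_le_one fun _ _ => sq_nonneg _
  have h3 := hv.sq_le h0 ht
  have h4 : 0 ≤ ε ^ 2 * ∫ t in (0 : ℝ)..1, D 2 v t ^ 2 := by positivity
  have h5 : (∫ t in (0 : ℝ)..1, D 1 v t ^ 2) ≤ 0 := by
    by_contra hcon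
    push Not at hcon
    have := mul_pos hγ hcon
    linarith
  exact pow_eq_zero_iff two_ne_zero |>.1 (le_antisymm (h3.trans h5) (sq_nonneg _))

/-- A classical solution satisfies the weak equation against every test function for which the
boundary terms vanish. -/
lemma IsSolution.weak (hc : CoeffBound M a b c) (hs : IsSolution ε a b c f u) (hv : IsH2 v)
    (h0 : v 0 = 0) (h1 : v 1 = 0) (h0' : D 2 u 0 * D 1 v 0 = 0) (h1' : D 2 u 1 * D 1 v 1 = 0) :
    form ε a b c u v = ∫ t in (0 : ℝ)..1, f t * v t := by
  have hu4 : ContDiffOn ℝ (4 : ℕ) u (Icc 0 1) := by exact_mod_cast hs.smooth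
  have hu : IsH2 u := IsH2.of_contDiffOn (by norm_num) hu4
  have hau : ContDiffOn ℝ 1 (fun s => a s * D 1 u s) (Icc 0 1) := by
    refine hc.a_smooth.mul ?_
    have hd : D 1 u = derivWithin u (Icc 0 1) := by rw [D_succ 0, D_zero]
    rw [hd]
    exact hs.smooth.derivWithin uniqueDiffOn_unit (by norm_num)
  set q : ℝ → ℝ := derivWithin (fun s => a s * D 1 u s) (Icc 0 1) with hq
  have hqc : ContinuousOn q (Icc 0 1) := hau.continuousOn_derivWithin uniqueDiffOn_unit le_rfl
  obtain ⟨p, hp, hp'⟩ := hv.diff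
  -- `G` collects all boundary terms of the integrations by parts: adding `G'` to the integrand of
  -- the form leaves `f v`. The fundamental theorem is needed off a countable set because `v''` may
  -- fail to exist at the nodes.
  set G : ℝ → ℝ := fun t => ε ^ 2 * (D 3 u t * v t - D 2 u t * D 1 v t) - a t * D 1 u t * v t
  set G' : ℝ → ℝ := fun t => ε ^ 2 * ((D 4 u t * v t + D 3 u t * D 1 v t)
    - (D 3 u t * D 1 v t + D 2 u t * D 2 v t)) - (q t * v t + a t * D 1 u t * D 1 v t)
  have c3 := continuousOn_D hu4 (k := 3) (by norm_num)
  have c2 := continuousOn_D hu4 (k := 2) (by norm_num)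
  have c4 := continuousOn_D hu4 (k := 4) (by norm_num)
  have hGc : ContinuousOn G (Icc 0 1) :=
    (continuousOn_const.mul ((c3.mul hv.continuousOn).sub (c2.mul hv.continuousOn_D_one))).sub
      (hau.continuousOn.mul hv.continuousOn)
  have hGd : ∀ t ∈ Ioo (0 : ℝ) 1 \ p, HasDerivAt G (G' t) t := by
    intro t ht
    have d3 := hasDerivAt_D hu4 (k := 3) (by norm_num) ht.1
    have d2 := hasDerivAt_D hu4 (k := 2) (by norm_num) ht.1
    have da : HasDerivAt (fun s => a s * D 1 u s) (q t) t :=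
      ((hau.differentiableOn one_ne_zero t
        (Ioo_subset_Icc_self ht.1)).hasDerivWithinAt).hasDerivAt (Icc_mem_nhds ht.1.1 ht.1.2)
    exact (((d3.mul (hv.hasDerivAt ht.1)).sub (d2.mul (hp' t ht))).const_mul _).sub
      (da.mul (hv.hasDerivAt ht.1))
  have hG'm : MemLp G' ⊤ unitMeasure := by
    have m2 := memLp_of_continuousOn c2
    have m3 := memLp_of_continuousOn c3
    have m4 := memLp_of_continuousOn c4
    exact ((((memLp_mul m4 hv.memLp).add (memLp_mul m3 hv.memLp_D_one)).sub
      ((memLp_mul m3 hv.memLp_D_one).add (memLp_mul m2 hv.bdd))).const_mul _).sub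
      ((memLp_mul (memLp_of_continuousOn hqc) hv.memLp).add
        (memLp_mul (memLp_of_continuousOn hau.continuousOn) hv.memLp_D_one))
  have hftc : ∫ t in (0 : ℝ)..1, G' t = G 1 - G 0 :=
    integral_eq_of_hasDerivAt_off_countable_of_le G G' zero_le_one hp hGc hGd
      ((intervalIntegrable_iff_integrableOn_Ioc_of_le zero_le_one).2 (integrable_of_memLp hG'm))
  have hG1 : G 1 = 0 := by simp [G, h1, h1']
  have hG0 : G 0 = 0 := by simp [G, h0, h0']
  rw [hG1, hG0, sub_zero, integral_unit] at hftc
  have hsum := integral_add (integrable_of_memLp (memLp_form hc hu hv ε)) (integrable_of_memLp hG'm)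
  rw [hftc, add_zero] at hsum
  rw [form, integral_unit, integral_unit, ← hsum]
  refine integral_congr_ae ?_
  filter_upwards [ae_unit_of_countable countable_empty] with t ht
  rw [← hs.eqn t ht.1]
  simp only [L2, G', ← hq]
  ring

end Form

/-! ### Estimates on a single cell -/

/-- Young's inequality `q g ≤ m² q² / 2 + g² / (2 m²)`: by `hgp` the last term integrates to at most
half of the left side and is absorbed. -/
lemma integral_sq_le_of_eq_integral_mul {x y m : ℝ} (hxy : x ≤ y) (hm : 0 < m) {p q g : ℝ → ℝ}
    (hq : ContinuousOn q (Icc x y)) (hg : ContinuousOn g (Icc x y))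
    (heq : ∫ t in x..y, p t ^ 2 = ∫ t in x..y, q t * g t)
    (hgp : ∫ t in x..y, g t ^ 2 ≤ m ^ 2 * ∫ t in x..y, p t ^ 2) :
    ∫ t in x..y, p t ^ 2 ≤ m ^ 2 * ∫ t in x..y, q t ^ 2 := by
  have iq : IntervalIntegrable (fun t => m ^ 2 / 2 * q t ^ 2) volume x y :=
    (continuousOn_const.mul (hq.pow 2)).intervalIntegrable_of_Icc hxy
  have ig : IntervalIntegrable (fun t => 1 / (2 * m ^ 2) * g t ^ 2) volume x y :=
    (continuousOn_const.mul (hg.pow 2)).intervalIntegrable_of_Icc hxy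
  have h := intervalIntegral.integral_mono_on (μ := volume) hxy
    ((hq.mul hg).intervalIntegrable_of_Icc hxy) (iq.add ig) fun t _ => by
      have h0 : 0 ≤ (m ^ 2 * q t - g t) ^ 2 / (2 * m ^ 2) := by positivity
      have h1 : (m ^ 2 * q t - g t) ^ 2 / (2 * m ^ 2)
          = m ^ 2 / 2 * q t ^ 2 + 1 / (2 * m ^ 2) * g t ^ 2 - q t * g t := by
        field_simp
        ring
      show q t * g t ≤ m ^ 2 / 2 * q t ^ 2 + 1 / (2 * m ^ 2) * g t ^ 2
      linarith
  rw [intervalIntegral.integral_add iq ig, intervalIntegral.integral_const_mul,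
    intervalIntegral.integral_const_mul] at h
  have h2 : 1 / (2 * m ^ 2) * ∫ t in x..y, g t ^ 2
      ≤ 1 / (2 * m ^ 2) * (m ^ 2 * ∫ t in x..y, p t ^ 2) := by gcongr
  have h3 : 1 / (2 * m ^ 2) * (m ^ 2 * ∫ t in x..y, p t ^ 2) = (∫ t in x..y, p t ^ 2) / 2 := by
    field_simp
  have h4 : ∫ t in x..y, p t ^ 2 ≤ m ^ 2 / 2 * (∫ t in x..y, q t ^ 2)
      + 1 / (2 * m ^ 2) * ∫ t in x..y, g t ^ 2 := heq.le.trans h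
  linarith

section Cell

variable {x y : ℝ} {z z₁ z₂ z₃ z₄ : ℝ → ℝ}

/-- Integrate by parts once: `∫ z₂² = -∫ (z₃ - c) z₁`, and `c ∫ z₁ = 0` since `z` vanishes at both
ends. In the application `c` is the third derivative of the interpolating cubic, so the bound
involves `u'''` alone. -/
lemma integral_sq_second_le_third (hxy : x < y) (c : ℝ) (c0 : ContinuousOn z (Icc x y))
    (c1 : ContinuousOn z₁ (Icc x y)) (c2 : ContinuousOn z₂ (Icc x y))
    (c3 : ContinuousOn z₃ (Icc x y)) (d0 : ∀ t ∈ Ioo x y, HasDerivAt z (z₁ t) t)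
    (d1 : ∀ t ∈ Ioo x y, HasDerivAt z₁ (z₂ t) t)
    (d2 : ∀ t ∈ Ioo x y, HasDerivAt z₂ (z₃ t - c) t)
    (hx : z x = 0) (hy : z y = 0) (hx' : z₁ x = 0) (hy' : z₁ y = 0) :
    ∫ t in x..y, z₂ t ^ 2 ≤ (y - x) ^ 2 * ∫ t in x..y, z₃ t ^ 2 := by
  refine integral_sq_le_of_eq_integral_mul (g := fun t => -z₁ t) hxy.le (sub_pos.2 hxy) c3 c1.neg
    ?_ ?_
  · have hi1 : IntervalIntegrable (fun t => z₂ t ^ 2) volume x y :=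
      (c2.pow 2).intervalIntegrable_of_Icc hxy.le
    have hi2 : IntervalIntegrable (fun t => z₃ t * -z₁ t) volume x y :=
      (c3.mul c1.neg).intervalIntegrable_of_Icc hxy.le
    have h := intervalIntegral.integral_eq_sub_of_hasDerivAt_of_le
      (f := fun t => z₂ t * z₁ t + c * z t) (f' := fun t => z₂ t ^ 2 - z₃ t * -z₁ t) hxy.le
      ((c2.mul c1).add (continuousOn_const.mul c0))
      (fun t ht => (((d2 t ht).mul (d1 t ht)).add ((d0 t ht).const_mul c)).congr_deriv (by ring))
      (hi1.sub hi2)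
    rw [intervalIntegral.integral_sub hi1 hi2] at h
    simp only [hx, hy, hx', hy', mul_zero, add_zero, sub_zero] at h
    linarith
  · simpa using integral_sq_le_of_eq_zero_left hxy.le c1 c2 d1 hx'

/-- Integrate by parts twice to get `∫ z₂² = ∫ z₄ z`, then apply Poincaré to `z` and to `z₁`. -/
lemma integral_sq_second_le_fourth (hxy : x < y) (c0 : ContinuousOn z (Icc x y))
    (c1 : ContinuousOn z₁ (Icc x y)) (c2 : ContinuousOn z₂ (Icc x y))
    (c3 : ContinuousOn z₃ (Icc x y)) (c4 : ContinuousOn z₄ (Icc x y))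
    (d0 : ∀ t ∈ Ioo x y, HasDerivAt z (z₁ t) t)
    (d1 : ∀ t ∈ Ioo x y, HasDerivAt z₁ (z₂ t) t) (d2 : ∀ t ∈ Ioo x y, HasDerivAt z₂ (z₃ t) t)
    (d3 : ∀ t ∈ Ioo x y, HasDerivAt z₃ (z₄ t) t)
    (hx : z x = 0) (hy : z y = 0) (hx' : z₁ x = 0) (hy' : z₁ y = 0) :
    ∫ t in x..y, z₂ t ^ 2 ≤ (y - x) ^ 4 * ∫ t in x..y, z₄ t ^ 2 := by
  have hm : 0 < (y - x) ^ 2 := pow_pos (sub_pos.2 hxy) 2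
  have := integral_sq_le_of_eq_integral_mul (p := z₂) hxy.le hm c4 c0 ?_ ?_
  · rwa [← pow_mul] at this
  · have hi1 : IntervalIntegrable (fun t => z₂ t ^ 2) volume x y :=
      (c2.pow 2).intervalIntegrable_of_Icc hxy.le
    have hi2 : IntervalIntegrable (fun t => z₄ t * z t) volume x y :=
      (c4.mul c0).intervalIntegrable_of_Icc hxy.le
    have h := intervalIntegral.integral_eq_sub_of_hasDerivAt_of_le
      (f := fun t => z₂ t * z₁ t - z₃ t * z t) (f' := fun t => z₂ t ^ 2 - z₄ t * z t) hxy.le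
      ((c2.mul c1).sub (c3.mul c0))
      (fun t ht => (((d2 t ht).mul (d1 t ht)).sub ((d3 t ht).mul (d0 t ht))).congr_deriv (by ring))
      (hi1.sub hi2)
    rw [intervalIntegral.integral_sub hi1 hi2] at h
    simp only [hx, hy, hx', hy', mul_zero, sub_zero] at h
    linarith
  · have h1 := integral_sq_le_of_eq_zero_left hxy.le c0 c1 d0 hx
    have h2 := integral_sq_le_of_eq_zero_left hxy.le c1 c2 d1 hx'
    calc _ ≤ _ := h1
      _ ≤ (y - x) ^ 2 * ((y - x) ^ 2 * ∫ t in x..y, z₂ t ^ 2) := by gcongr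
      _ = _ := by ring

end Cell

/-! ### Partitions of the unit interval and piecewise cubics -/

/-- `x 0 < ... < x m` is a partition of `[0,1]`. -/
structure IsPartition (x : ℕ → ℝ) (m : ℕ) : Prop where
  zero : x 0 = 0
  one : x m = 1
  lt : ∀ i < m, x i < x (i + 1)

namespace IsPartition

variable {x : ℕ → ℝ} {m : ℕ}

lemma mono (hx : IsPartition x m) {i j : ℕ} (hij : i ≤ j) (hj : j ≤ m) : x i ≤ x j := by
  induction j, hij using Nat.le_induction with
  | base => exact le_rfl
  | succ k hk ih => exact (ih (by omega)).trans (hx.lt k (by omega)).le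

lemma mem_Icc (hx : IsPartition x m) {i : ℕ} (hi : i ≤ m) : x i ∈ Icc (0 : ℝ) 1 :=
  ⟨hx.zero ▸ hx.mono (Nat.zero_le i) hi, hx.one ▸ hx.mono hi le_rfl⟩

lemma cell_subset (hx : IsPartition x m) {i : ℕ} (hi : i < m) :
    Icc (x i) (x (i + 1)) ⊆ Icc 0 1 :=
  Icc_subset_Icc (hx.mem_Icc hi.le).1 (hx.mem_Icc (Nat.succ_le_of_lt hi)).2

lemma open_cell_subset (hx : IsPartition x m) {i : ℕ} (hi : i < m) :
    Ioo (x i) (x (i + 1)) ⊆ Ioo 0 1 :=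
  Ioo_subset_Ioo (hx.mem_Icc hi.le).1 (hx.mem_Icc (Nat.succ_le_of_lt hi)).2

lemma exists_cell (hx : IsPartition x m) {t : ℝ} (ht : t ∈ Icc (0 : ℝ) 1) :
    ∃ i < m, t ∈ Icc (x i) (x (i + 1)) := by
  have key : ∀ k ≤ m, t ≤ x k → k ≠ 0 → ∃ i < m, t ∈ Icc (x i) (x (i + 1)) := by
    intro k
    induction k with
    | zero => intro _ _ h; exact absurd rfl h
    | succ k ih =>
      intro hk htk _
      by_cases h : x k ≤ t
      · exact ⟨k, by omega, h, htk⟩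
      · rcases Nat.eq_zero_or_pos k with rfl | hpos
        · exact ⟨0, by omega, hx.zero ▸ ht.1, htk⟩
        · exact ih (by omega) (not_le.1 h).le hpos.ne'
  refine key m le_rfl (hx.one ▸ ht.2) ?_
  rintro rfl
  have := hx.zero.symm.trans hx.one
  norm_num at this

end IsPartition

/-- Cubic `C^1` splines on a partition. -/
structure IsCubicSpline (x : ℕ → ℝ) (m : ℕ) (v : ℝ → ℝ) : Prop where
  smooth : ContDiffOn ℝ 1 v (Icc 0 1)
  cubic : ∀ i < m, ∃ q : Polynomial ℝ, q.natDegree ≤ 3 ∧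
    ∀ t ∈ Icc (x i) (x (i + 1)), v t = q.eval t

section Spline

variable {x : ℕ → ℝ} {m : ℕ} {v w : ℝ → ℝ}

lemma hasDerivAt_D_one_of_eqOn_polynomial {α β : ℝ} (hsub : Ioo α β ⊆ Ioo 0 1)
    {q : Polynomial ℝ} (hq : ∀ t ∈ Icc α β, v t = q.eval t) {t : ℝ} (ht : t ∈ Ioo α β) :
    HasDerivAt (D 1 v) (q.derivative.derivative.eval t) t := by
  refine (q.derivative.hasDerivAt t).congr_of_eventuallyEq ?_
  filter_upwards [isOpen_Ioo.mem_nhds ht] with s hs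
  refine D_one_of_hasDerivWithinAt (Ioo_subset_Icc_self (hsub hs))
    (HasDerivAt.hasDerivWithinAt ?_)
  refine (q.hasDerivAt s).congr_of_eventuallyEq ?_
  filter_upwards [isOpen_Ioo.mem_nhds hs] with r hr using hq r (Ioo_subset_Icc_self hr)

lemma IsCubicSpline.isH2 (hx : IsPartition x m) (hv : IsCubicSpline x m v) : IsH2 v := by
  have hb : ∀ i : ℕ, ∃ B : ℝ, i < m → ∀ t ∈ Ioo (x i) (x (i + 1)),
      ∃ y, |y| ≤ B ∧ HasDerivAt (D 1 v) y t := by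
    intro i
    by_cases hi : i < m
    · obtain ⟨q, -, hq⟩ := hv.cubic i hi
      obtain ⟨B, hB⟩ := isCompact_Icc.exists_bound_of_continuousOn
        (q.derivative.derivative.continuous.continuousOn (s := Icc (x i) (x (i + 1))))
      exact ⟨B, fun _ t ht => ⟨_, hB t (Ioo_subset_Icc_self ht),
        hasDerivAt_D_one_of_eqOn_polynomial (hx.open_cell_subset hi) hq ht⟩⟩
    · exact ⟨0, fun h => absurd h hi⟩
  choose B hB using hb
  refine IsH2.of_bound hv.smooth (s := range x) (countable_range x)
    (B := ∑ i ∈ Finset.range m, |B i|) fun t ht => ?_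
  obtain ⟨i, hi, h1, h2⟩ := hx.exists_cell (Ioo_subset_Icc_self ht.1)
  have h1' : x i ≠ t := fun h => ht.2 ⟨i, h⟩
  have h2' : t ≠ x (i + 1) := fun h => ht.2 ⟨i + 1, h.symm⟩
  obtain ⟨y, hy, hd⟩ := hB i hi t ⟨lt_of_le_of_ne h1 h1', lt_of_le_of_ne h2 h2'⟩
  exact ⟨y, (hy.trans (le_abs_self _)).trans (Finset.single_le_sum (f := fun i => |B i|)
    (fun _ _ => abs_nonneg _) (Finset.mem_range.2 hi)), hd⟩

lemma IsCubicSpline.lincomb (hv : IsCubicSpline x m v) (hw : IsCubicSpline x m w) (r s : ℝ) :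
    IsCubicSpline x m (fun t => r * v t + s * w t) where
  smooth := (contDiffOn_const.mul hv.smooth).add (contDiffOn_const.mul hw.smooth)
  cubic := by
    intro i hi
    obtain ⟨p, hp, hp'⟩ := hv.cubic i hi
    obtain ⟨q, hq, hq'⟩ := hw.cubic i hi
    refine ⟨Polynomial.C r * p + Polynomial.C s * q, ?_, fun t ht => by simp [hp' t ht, hq' t ht]⟩
    exact Polynomial.natDegree_add_le_of_degree_le
      ((Polynomial.natDegree_C_mul_le _ _).trans hp) ((Polynomial.natDegree_C_mul_le _ _).trans hq)

lemma IsCubicSpline.congr (hx : IsPartition x m) (hv : IsCubicSpline x m v)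
    (h : EqOn w v (Icc 0 1)) : IsCubicSpline x m w where
  smooth := hv.smooth.congr h
  cubic := by
    intro i hi
    obtain ⟨p, hp, hp'⟩ := hv.cubic i hi
    exact ⟨p, hp, fun t ht => (h (hx.cell_subset hi ht)).trans (hp' t ht)⟩

/-- The four equidistant points of a cell, including its end points. -/
noncomputable def samplePoint (x : ℕ → ℝ) (i : ℕ) (j : Fin 4) : ℝ :=
  x i + (j : ℝ) / 3 * (x (i + 1) - x i)

/-- A cubic spline is determined by four values in each cell. -/
lemma IsCubicSpline.eq_zero_of_sample (hx : IsPartition x m) (hv : IsCubicSpline x m v)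
    (h : ∀ i < m, ∀ j : Fin 4, v (samplePoint x i j) = 0) : ∀ t ∈ Icc (0 : ℝ) 1, v t = 0 := by
  intro t ht
  obtain ⟨i, hi, hti⟩ := hx.exists_cell ht
  obtain ⟨q, hq, hq'⟩ := hv.cubic i hi
  have hd : 0 < x (i + 1) - x i := sub_pos.2 (hx.lt i hi)
  have hinj : Function.Injective (samplePoint x i) := by
    intro j k hjk
    simp only [samplePoint, add_right_inj] at hjk
    have h1 := mul_right_cancel₀ hd.ne' hjk
    have h2 : (j : ℝ) = k := by linarith
    exact Fin.ext (by exact_mod_cast h2)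
  have hmem : ∀ j, samplePoint x i j ∈ Icc (x i) (x (i + 1)) := by
    intro j
    have h0 : (0 : ℝ) ≤ (j : ℝ) / 3 := by positivity
    have h1 : (j : ℝ) / 3 ≤ 1 := by
      have : (j : ℕ) ≤ 3 := by omega
      have : ((j : ℕ) : ℝ) ≤ 3 := by exact_mod_cast this
      linarith
    constructor <;> simp only [samplePoint] <;> nlinarith
  have : q = 0 := Polynomial.eq_zero_of_natDegree_lt_card_of_eval_eq_zero q hinj
    (fun j => by rw [← hq' _ (hmem j), h i hi j]) (by simpa using Nat.lt_succ_of_le hq)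
  rw [hq' t hti, this, Polynomial.eval_zero]

end Spline

/-! ### The Galerkin problem in a spline space -/

/-- A linear space of cubic splines vanishing at `0` and `1`, where only the values on `[0,1]`
matter. -/
structure IsSplineSpace (x : ℕ → ℝ) (m : ℕ) (V : Set (ℝ → ℝ)) : Prop where
  spline : ∀ v ∈ V, IsCubicSpline x m v
  left : ∀ v ∈ V, v 0 = 0
  right : ∀ v ∈ V, v 1 = 0
  zero : (fun _ => 0) ∈ V
  lincomb : ∀ v ∈ V, ∀ w ∈ V, ∀ r s : ℝ, (fun t => r * v t + s * w t) ∈ V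
  congr : ∀ v ∈ V, ∀ w, EqOn w v (Icc 0 1) → w ∈ V

namespace IsSplineSpace

variable {x : ℕ → ℝ} {m : ℕ} {V : Set (ℝ → ℝ)}

/-- The members of the space that vanish outside `[0,1]`. -/
def supported (hV : IsSplineSpace x m V) : Submodule ℝ (ℝ → ℝ) where
  carrier := {v | v ∈ V ∧ ∀ t ∉ Icc (0 : ℝ) 1, v t = 0}
  zero_mem' := ⟨hV.zero, fun _ _ => rfl⟩
  add_mem' := by
    rintro v w ⟨hv, hv'⟩ ⟨hw, hw'⟩
    refine ⟨?_, fun t ht => by simp [hv' t ht, hw' t ht]⟩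
    convert hV.lincomb v hv w hw 1 1 using 2
    simp
  smul_mem' := by
    rintro r v ⟨hv, hv'⟩
    refine ⟨?_, fun t ht => by simp [hv' t ht]⟩
    convert hV.lincomb v hv v hv r 0 using 2
    simp

lemma indicator_mem_supported (hV : IsSplineSpace x m V) {v : ℝ → ℝ} (hv : v ∈ V) :
    indicator (Icc 0 1) v ∈ hV.supported :=
  ⟨hV.congr v hv _ fun _ ht => indicator_of_mem ht v, fun _ ht => indicator_of_notMem ht v⟩

/-- The set `V` leaves values outside `[0,1]` free, so finite dimension needs the support condition.
Sampling four points per cell is then injective. -/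
lemma finiteDimensional_supported (hx : IsPartition x m) (hV : IsSplineSpace x m V) :
    FiniteDimensional ℝ hV.supported := by
  let φ : hV.supported →ₗ[ℝ] (Fin m × Fin 4 → ℝ) :=
    { toFun := fun v p => (v : ℝ → ℝ) (samplePoint x p.1 p.2)
      map_add' := fun _ _ => rfl
      map_smul' := fun _ _ => rfl }
  refine Module.Finite.of_injective φ ((injective_iff_map_eq_zero φ).2 fun v hv => ?_)
  ext t
  by_cases ht : t ∈ Icc (0 : ℝ) 1
  · exact (hV.spline v v.2.1).eq_zero_of_sample hx
      (fun i hi j => congrFun hv (⟨i, hi⟩, j)) t ht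
  · exact v.2.2 t ht

variable {ε γ M : ℝ} {a b c f u : ℝ → ℝ}

lemma isH2 (hx : IsPartition x m) (hV : IsSplineSpace x m V) {v : ℝ → ℝ} (hv : v ∈ V) : IsH2 v :=
  (hV.spline v hv).isH2 hx

/-- Every functional `form u` is represented by a member of the space. -/
lemma exists_form_eq (hx : IsPartition x m) (hV : IsSplineSpace x m V) (hγ : 0 < γ)
    (hc : CoeffBound M a b c) (hell : IsElliptic γ a b c) (hu : IsH2 u) :
    ∃ w ∈ V, ∀ v ∈ V, form ε a b c w v = form ε a b c u v := by
  have := hV.finiteDimensional_supported hx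
  have h2 : ∀ v : hV.supported, IsH2 (v : ℝ → ℝ) := fun v => hV.isH2 hx v.2.1
  have hadd : ∀ v w : ℝ → ℝ, v + w = fun t => 1 * v t + 1 * w t := by
    intro v w; funext t; simp
  have hsmul : ∀ (r : ℝ) (v : ℝ → ℝ), r • v = fun t => r * v t + 0 * v t := by
    intro r v; funext t; simp
  let B : hV.supported →ₗ[ℝ] hV.supported →ₗ[ℝ] ℝ :=
    LinearMap.mk₂ ℝ (fun v w => form ε a b c v w)
      (fun v v' w => by
        rw [Submodule.coe_add, hadd, form_lincomb_left hc (h2 v) (h2 v') (h2 w)]; ring)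
      (fun r v w => by
        rw [Submodule.coe_smul, hsmul, form_lincomb_left hc (h2 v) (h2 v) (h2 w)]
        rw [smul_eq_mul]; ring)
      (fun v w w' => by
        rw [Submodule.coe_add, hadd, form_lincomb_right hc (h2 w) (h2 w') (h2 v)]; ring)
      (fun r v w => by
        rw [Submodule.coe_smul, hsmul, form_lincomb_right hc (h2 w) (h2 w) (h2 v)]
        rw [smul_eq_mul]; ring)
  let F : hV.supported →ₗ[ℝ] ℝ :=
    { toFun := fun w => form ε a b c u w
      map_add' := fun w w' => by
        rw [Submodule.coe_add, hadd, form_lincomb_right hc (h2 w) (h2 w') hu]; ring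
      map_smul' := fun r w => by
        rw [Submodule.coe_smul, hsmul, form_lincomb_right hc (h2 w) (h2 w) hu]
        rw [RingHom.id_apply, smul_eq_mul]; ring }
  -- Coercivity gives injectivity; a finite-dimensional space and its dual have equal dimension, so
  -- surjectivity follows.
  have hinj : Function.Injective B := by
    refine (injective_iff_map_eq_zero B).2 fun v hv => ?_
    have hvv : form ε a b c v v = 0 := LinearMap.congr_fun hv v
    ext t
    by_cases ht : t ∈ Icc (0 : ℝ) 1
    · exact eq_zero_of_form_self_eq_zero hγ hc hell (h2 v) (hV.left v v.2.1) (hV.right v v.2.1)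
        hvv t ht
    · exact v.2.2 t ht
  have hsurj : Function.Surjective B :=
    (LinearMap.injective_iff_surjective_of_finrank_eq_finrank
      (Subspace.dual_finrank_eq (K := ℝ) (V := hV.supported)).symm).1 hinj
  obtain ⟨w, hw⟩ := hsurj F
  refine ⟨w, w.2.1, fun v hv => ?_⟩
  -- A general test function is replaced by its restriction to `[0,1]`, which is all the form sees.
  have h := LinearMap.congr_fun hw ⟨_, hV.indicator_mem_supported hv⟩
  have hvi : EqOn v (indicator (Icc 0 1) v) (Icc 0 1) := fun t ht => (indicator_of_mem ht v).symm
  rw [form_congr (eqOn_refl _ _) hvi, form_congr (u := u) (eqOn_refl _ _) hvi]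
  exact h

/-- The Galerkin problem is uniquely solvable, and its error is bounded by that of any member
of the space. -/
lemma galerkinErrorLE (hx : IsPartition x m) (hV : IsSplineSpace x m V) (hγ : 0 < γ) (hε : 0 < ε)
    (hc : CoeffBound M a b c) (hell : IsElliptic γ a b c) (hu : IsH2 u)
    (hu0 : u 0 = 0) (hu1 : u 1 = 0)
    (hweak : ∀ v ∈ V, form ε a b c u v = ∫ t in (0 : ℝ)..1, f t * v t)
    {g : ℝ → ℝ} (hg : g ∈ V) {A : ℝ} (hA : 0 ≤ A)
    (h2 : ε ^ 2 * (∫ t in (0 : ℝ)..1, D 2 (fun s => u s - g s) t ^ 2) ≤ A ^ 2)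
    (h1 : ∫ t in (0 : ℝ)..1, D 1 (fun s => u s - g s) t ^ 2 ≤ A ^ 2) :
    GalerkinErrorLE ε a b c f u V
      (Real.sqrt (1 + 12 * M ^ 2 / γ) * (1 + 1 / Real.sqrt γ) * A) := by
  -- The discrete solution is built as the Galerkin projection of `u`; `hweak` then replaces `form
  -- u` by the load. No integrability of `f` has to be discussed.
  obtain ⟨w, hw, hwu⟩ := hV.exists_form_eq (ε := ε) hx hγ hc hell hu
  have hsub : ∀ p q : ℝ → ℝ, (fun t => p t - q t) = fun t => 1 * p t + (-1) * q t := by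
    intro p q; funext t; ring
  have hwH := hV.isH2 hx hw
  have hgH := hV.isH2 hx hg
  have horth : ∀ v ∈ V, form ε a b c (fun t => u t - w t) v = 0 := by
    intro v hv
    rw [hsub, form_lincomb_left hc hu hwH (hV.isH2 hx hv), hwu v hv]
    ring
  refine ⟨w, ⟨hw, fun v hv => (hwu v hv).trans (hweak v hv)⟩, ?_, ?_⟩
  · rintro w' ⟨hw', hw'f⟩ t ht
    have hmem : (fun t => w' t - w t) ∈ V := by
      rw [hsub]; exact hV.lincomb w' hw' w hw 1 (-1)
    have hH := hV.isH2 hx hmem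
    have h0 : form ε a b c (fun t => 1 * w' t + (-1) * w t) (fun t => w' t - w t) = 0 := by
      rw [form_lincomb_left hc (hV.isH2 hx hw') hwH hH, hw'f _ hmem, hwu _ hmem, hweak _ hmem]
      ring
    rw [← hsub] at h0
    have := eq_zero_of_form_self_eq_zero hγ hc hell hH (hV.left _ hmem) (hV.right _ hmem) h0 t ht
    exact sub_eq_zero.1 this
  · set e : ℝ → ℝ := fun t => u t - w t with he
    set z : ℝ → ℝ := fun t => u t - g t with hz
    have heH : IsH2 e := hu.sub hwH
    have hzH : IsH2 z := hu.sub hgH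
    have he0 : e 0 = 0 := by simp [he, hu0, hV.left w hw]
    have he1 : e 1 = 0 := by simp [he, hu1, hV.right w hw]
    have hz0 : z 0 = 0 := by simp [hz, hu0, hV.left g hg]
    have hgw : (fun t => 1 * g t + (-1) * w t) ∈ V := hV.lincomb g hg w hw 1 (-1)
    -- The error is `z` plus an element `g - w` of the space, to which it is orthogonal.
    have hez : e = fun t => 1 * z t + 1 * (1 * g t + (-1) * w t) := by
      funext t; simp only [he, hz]; ring
    have hee : form ε a b c e e = form ε a b c e z := by
      calc form ε a b c e e = form ε a b c e (fun t => 1 * z t + 1 * (1 * g t + (-1) * w t)) := by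
            rw [← hez]
        _ = 1 * form ε a b c e z + 1 * form ε a b c e (fun t => 1 * g t + (-1) * w t) :=
            form_lincomb_right hc hzH (hV.isH2 hx hgw) heH 1 1
        _ = _ := by rw [horth _ hgw]; ring
    have hcea := cea hγ hc hell heH hzH he0 he1 hz0 hee
    have hQ : 0 ≤ 12 * M ^ 2 / γ := by positivity
    set X := ∫ t in (0 : ℝ)..1, D 2 e t ^ 2
    set Y := ∫ t in (0 : ℝ)..1, D 1 e t ^ 2
    have hX : 0 ≤ X := intervalIntegral.integral_nonneg zero_le_one fun _ _ => sq_nonneg _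
    have hY : 0 ≤ Y := intervalIntegral.integral_nonneg zero_le_one fun _ _ => sq_nonneg _
    have htot : ε ^ 2 * X + γ * Y ≤ (1 + 12 * M ^ 2 / γ) * A ^ 2 := by
      have := mul_le_mul_of_nonneg_left h1 hQ
      linarith
    set R := Real.sqrt (1 + 12 * M ^ 2 / γ) with hR
    have hRsq : (R * A) ^ 2 = (1 + 12 * M ^ 2 / γ) * A ^ 2 := by
      rw [mul_pow, hR, Real.sq_sqrt (by positivity)]
    have hRA : 0 ≤ R * A := mul_nonneg (Real.sqrt_nonneg _) hA
    have hγY : 0 ≤ γ * Y := by positivity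
    have hεX : 0 ≤ ε ^ 2 * X := by positivity
    have s2 : ε * Real.sqrt X ≤ R * A := by
      refine abs_le_of_sq_le_sq' ?_ hRA |>.2
      rw [mul_pow, Real.sq_sqrt hX, hRsq]
      linarith
    have s1 : Real.sqrt γ * Real.sqrt Y ≤ R * A := by
      refine abs_le_of_sq_le_sq' ?_ hRA |>.2
      rw [mul_pow, Real.sq_sqrt hγ.le, Real.sq_sqrt hY, hRsq]
      linarith
    have hsγ : 0 < Real.sqrt γ := Real.sqrt_pos.2 hγ
    have s1' : Real.sqrt Y ≤ R * A / Real.sqrt γ := by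
      rw [le_div_iff₀ hsγ]; linarith
    have hn : epsNorm ε e = ε * Real.sqrt X + Real.sqrt Y := rfl
    rw [hn]
    have : R * (1 + 1 / Real.sqrt γ) * A = R * A + R * A / Real.sqrt γ := by ring
    linarith

end IsSplineSpace

/-! ### Cubic Hermite interpolation -/

/-- From exponent two on, the one-sided derivatives of a truncated power agree at the origin. This
lets a correction be switched on at a node without destroying `C^1` smoothness. -/
lemma hasDerivAt_max_zero_pow (n : ℕ) (s : ℝ) :
    HasDerivAt (fun t : ℝ => max t 0 ^ (n + 2)) ((n + 2) * max s 0 ^ (n + 1)) s := by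
  have hp : HasDerivAt (fun t : ℝ => t ^ (n + 2)) ((n + 2) * s ^ (n + 1)) s := by
    simpa using hasDerivAt_pow (n + 2) s
  rcases lt_trichotomy s 0 with hs | rfl | hs
  · rw [max_eq_right hs.le]
    have h0 : HasDerivAt (fun _ : ℝ => (0 : ℝ)) 0 s := hasDerivAt_const s 0
    refine (h0.congr_of_eventuallyEq ?_).congr_deriv (by simp)
    filter_upwards [isOpen_Iio.mem_nhds hs] with t ht
    simp [max_eq_right (le_of_lt (mem_Iio.1 ht))]
  · rw [← hasDerivWithinAt_univ, ← Iic_union_Ici (a := (0 : ℝ))]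
    refine HasDerivWithinAt.union ?_ ?_
    · have h0 : HasDerivWithinAt (fun _ : ℝ => (0 : ℝ)) 0 (Iic 0) 0 := hasDerivWithinAt_const ..
      refine (h0.congr (fun t ht => ?_) (by simp)).congr_deriv (by simp)
      simp [max_eq_right (mem_Iic.1 ht)]
    · refine (hp.hasDerivWithinAt.congr (fun t ht => ?_) (by simp)).congr_deriv (by simp)
      simp only [max_eq_left (mem_Ici.1 ht)]
  · rw [max_eq_left hs.le]
    refine hp.congr_of_eventuallyEq ?_
    filter_upwards [isOpen_Ioi.mem_nhds hs] with t ht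
    rw [max_eq_left (le_of_lt (mem_Ioi.1 ht))]

section Hermite

variable {x : ℕ → ℝ} {m : ℕ}

/-- Induction over the nodes: a combination of `(t - x k)₊²` and `(t - x k)₊³` leaves everything
left of `x k` unchanged and corrects value and slope at `x (k + 1)`. The clause that `g` is one
cubic to the right of `x k` is the invariant that keeps the next cell cubic. -/
lemma exists_hermite_aux (hx : IsPartition x m) (y y' : ℕ → ℝ) : ∀ k ≤ m, ∃ g g' : ℝ → ℝ,
    Continuous g' ∧ (∀ t, HasDerivAt g (g' t) t) ∧
    (∀ i < k, ∃ q : Polynomial ℝ, q.natDegree ≤ 3 ∧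
      ∀ t ∈ Icc (x i) (x (i + 1)), g t = q.eval t) ∧
    (∃ q : Polynomial ℝ, q.natDegree ≤ 3 ∧ ∀ t, x k ≤ t → g t = q.eval t) ∧
    ∀ i ≤ k, g (x i) = y i ∧ g' (x i) = y' i := by
  intro k
  induction k with
  | zero =>
    intro _
    refine ⟨fun t => y 0 + y' 0 * (t - x 0), fun _ => y' 0, continuous_const, fun t => ?_,
      fun i hi => absurd hi (Nat.not_lt_zero i),
      ⟨Polynomial.C (y 0 - y' 0 * x 0) + Polynomial.C (y' 0) * Polynomial.X, ?_, fun t _ => ?_⟩,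
      fun i hi => ?_⟩
    · exact ((((hasDerivAt_id t).sub_const (x 0)).const_mul (y' 0)).const_add (y 0)).congr_deriv
        (by simp)
    · compute_degree
      norm_num
    · simp; ring
    · obtain rfl : i = 0 := by omega
      simp
  | succ k ih =>
    intro hk
    obtain ⟨g, g', hg'c, hgd, hcell, ⟨q, hq, hq'⟩, hval⟩ := ih (by omega)
    set d := x (k + 1) - x k with hd
    have hlt := hx.lt k (by omega)
    have hdpos : 0 < d := sub_pos.2 hlt
    set P := y (k + 1) - g (x (k + 1)) with hP
    set Q := y' (k + 1) - g' (x (k + 1)) with hQ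
    -- `A` and `B` solve `A d² + B d³ = P` and `2 A d + 3 B d² = Q`.
    set A := 3 * P / d ^ 2 - Q / d with hA
    set B := Q / d ^ 2 - 2 * P / d ^ 3 with hB
    set T : ℝ → ℝ := fun t => A * max (t - x k) 0 ^ (0 + 2) + B * max (t - x k) 0 ^ (1 + 2)
      with hT
    set T' : ℝ → ℝ := fun t => A * (2 * max (t - x k) 0) + B * (3 * max (t - x k) 0 ^ 2) with hT'
    have hTd : ∀ t, HasDerivAt T (T' t) t := by
      intro t
      have h1 := (hasDerivAt_max_zero_pow 0 (t - x k)).comp_sub_const t (x k)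
      have h2 := (hasDerivAt_max_zero_pow 1 (t - x k)).comp_sub_const t (x k)
      refine ((h1.const_mul A).add (h2.const_mul B)).congr_deriv ?_
      simp only [hT']
      norm_num
    have hT0 : ∀ t ≤ x k, T t = 0 ∧ T' t = 0 := by
      intro t ht
      simp [hT, hT', max_eq_right (sub_nonpos.2 ht)]
    have hT1 : T (x (k + 1)) = P ∧ T' (x (k + 1)) = Q := by
      simp only [hT, hT', ← hd, max_eq_left hdpos.le, hA, hB]
      constructor <;> (field_simp; ring)
    have hpoly : ∃ q : Polynomial ℝ, q.natDegree ≤ 3 ∧ ∀ t, x k ≤ t → g t + T t = q.eval t := by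
      refine ⟨q + (Polynomial.C A * (Polynomial.X - Polynomial.C (x k)) ^ 2
        + Polynomial.C B * (Polynomial.X - Polynomial.C (x k)) ^ 3), ?_, fun t ht => ?_⟩
      · refine Polynomial.natDegree_add_le_of_degree_le hq ?_
        compute_degree
      · simp [hT, hq' t ht, max_eq_left (sub_nonneg.2 ht)]
    refine ⟨fun t => g t + T t, fun t => g' t + T' t, ?_, fun t => (hgd t).add (hTd t), ?_, ?_, ?_⟩
    · have : Continuous T' := by fun_prop
      exact hg'c.add this
    · intro i hi
      rcases (Nat.lt_succ_iff_lt_or_eq.1 hi) with hi | rfl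
      · obtain ⟨p, hp, hp'⟩ := hcell i hi
        refine ⟨p, hp, fun t ht => ?_⟩
        show g t + T t = _
        rw [(hT0 t (ht.2.trans (hx.mono hi (by omega)))).1, add_zero, hp' t ht]
      · obtain ⟨p, hp, hp'⟩ := hpoly
        exact ⟨p, hp, fun t ht => hp' t ht.1⟩
    · obtain ⟨p, hp, hp'⟩ := hpoly
      exact ⟨p, hp, fun t ht => hp' t (hlt.le.trans ht)⟩
    · intro i hi
      rcases hi.lt_or_eq with hi | rfl
      · obtain ⟨h1, h2⟩ := hT0 (x i) (hx.mono (by omega) (by omega))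
        obtain ⟨h3, h4⟩ := hval i (by omega)
        simp [h1, h2, h3, h4]
      · simp [hT1.1, hT1.2, hP, hQ]

/-- The cubic Hermite interpolant of given nodal values `y` and slopes `y'`. -/
lemma exists_hermite (hx : IsPartition x m) (y y' : ℕ → ℝ) : ∃ g : ℝ → ℝ,
    IsCubicSpline x m g ∧ ∀ i ≤ m, g (x i) = y i ∧ D 1 g (x i) = y' i := by
  obtain ⟨g, g', hc, hd, hcell, -, hval⟩ := exists_hermite_aux hx y y' m le_rfl
  have hderiv : deriv g = g' := funext fun t => (hd t).deriv
  have h1 : ContDiff ℝ 1 g :=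
    contDiff_one_iff_deriv.2 ⟨fun t => (hd t).differentiableAt, hderiv ▸ hc⟩
  refine ⟨g, ⟨h1.contDiffOn, hcell⟩, fun i hi => ⟨(hval i hi).1, ?_⟩⟩
  rw [D_one_of_hasDerivWithinAt (hx.mem_Icc hi) (hd _).hasDerivWithinAt, (hval i hi).2]

/-! ### The interpolation error -/

variable {u g : ℝ → ℝ}

lemma sum_integral_cells (hx : IsPartition x m) {F : ℝ → ℝ} (hF : Integrable F unitMeasure) :
    ∑ i ∈ Finset.range m, ∫ t in x i..x (i + 1), F t = ∫ t in (0 : ℝ)..1, F t := by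
  have h := intervalIntegral.sum_integral_adjacent_intervals (a := x) (n := m) (f := F)
    (μ := volume) fun k hk => by
      rw [intervalIntegrable_iff_integrableOn_Ioc_of_le (hx.lt k hk).le]
      exact IntegrableOn.mono_set hF
        (Ioc_subset_Ioc (hx.mem_Icc hk.le).1 (hx.mem_Icc (Nat.succ_le_of_lt hk)).2)
  rw [h, hx.zero, hx.one]

/-- Cellwise bounds for the error of Hermite interpolation. -/
lemma hermite_cell_error (hx : IsPartition x m) (hu : ContDiffOn ℝ (4 : ℕ) u (Icc 0 1))
    (hg : IsCubicSpline x m g)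
    (hint : ∀ i ≤ m, g (x i) = u (x i) ∧ D 1 g (x i) = D 1 u (x i)) {i : ℕ} (hi : i < m) :
    (∫ t in x i..x (i + 1), D 2 (fun s => u s - g s) t ^ 2
      ≤ (x (i + 1) - x i) ^ 4 * ∫ t in x i..x (i + 1), D 4 u t ^ 2) ∧
    (∫ t in x i..x (i + 1), D 2 (fun s => u s - g s) t ^ 2
      ≤ (x (i + 1) - x i) ^ 2 * ∫ t in x i..x (i + 1), D 3 u t ^ 2) ∧
    ∫ t in x i..x (i + 1), D 1 (fun s => u s - g s) t ^ 2
      ≤ (x (i + 1) - x i) ^ 2 * ∫ t in x i..x (i + 1), D 2 (fun s => u s - g s) t ^ 2 := by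
  have huH : IsH2 u := IsH2.of_contDiffOn (by norm_num) hu
  have hgH : IsH2 g := hg.isH2 hx
  have hzH : IsH2 (fun s => u s - g s) := huH.sub hgH
  have hlt := hx.lt i hi
  have hsub := hx.cell_subset hi
  have hosub := hx.open_cell_subset hi
  obtain ⟨q, hq, hq'⟩ := hg.cubic i hi
  have hD1 : ∀ t ∈ Icc (0 : ℝ) 1, D 1 (fun s => u s - g s) t = D 1 u t - D 1 g t := fun t ht =>
    D_one_of_hasDerivWithinAt ht ((huH.hasDerivWithinAt ht).sub (hgH.hasDerivWithinAt ht))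
  have hd1 : ∀ t ∈ Ioo (x i) (x (i + 1)), HasDerivAt (D 1 (fun s => u s - g s))
      (D 2 u t - q.derivative.derivative.eval t) t := by
    intro t ht
    refine ((hasDerivAt_D hu (k := 1) (by norm_num) (hosub ht)).sub
      (hasDerivAt_D_one_of_eqOn_polynomial hosub hq' ht)).congr_of_eventuallyEq ?_
    filter_upwards [isOpen_Ioo.mem_nhds ht] with s hs
    exact hD1 s (Ioo_subset_Icc_self (hosub hs))
  -- Inside the cell `D 2` of the error is replaced by an expression continuous up to the end
  -- points, where `D 2` itself is not controlled.
  have hD2 : ∫ t in x i..x (i + 1), D 2 (fun s => u s - g s) t ^ 2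
      = ∫ t in x i..x (i + 1), (D 2 u t - q.derivative.derivative.eval t) ^ 2 := by
    refine intervalIntegral.integral_congr_Ioo_of_le hlt.le fun t ht => ?_
    simp only [D_two_of_hasDerivAt (hosub ht) (hd1 t ht)]
  have hd2 : ∀ t ∈ Ioo (x i) (x (i + 1)),
      HasDerivAt (fun t => D 2 u t - q.derivative.derivative.eval t)
        (D 3 u t - q.derivative.derivative.derivative.eval t) t := fun t ht =>
    (hasDerivAt_D hu (k := 2) (by norm_num) (hosub ht)).sub (q.derivative.derivative.hasDerivAt t)
  have hq4 : q.derivative.derivative.derivative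
      = Polynomial.C (q.derivative.derivative.derivative.coeff 0) := by
    refine Polynomial.eq_C_of_natDegree_le_zero ?_
    have h1 := Polynomial.natDegree_derivative_le q
    have h2 := Polynomial.natDegree_derivative_le q.derivative
    have h3 := Polynomial.natDegree_derivative_le q.derivative.derivative
    omega
  set c := q.derivative.derivative.derivative.coeff 0
  have hqc : ∀ t, q.derivative.derivative.derivative.eval t = c := by
    intro t; rw [hq4, Polynomial.eval_C]
  simp only [hqc] at hd2
  have c0 : ContinuousOn (fun s => u s - g s) (Icc (x i) (x (i + 1))) := hzH.continuousOn.mono hsub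
  have c1 := hzH.continuousOn_D_one.mono hsub
  have c2 : ContinuousOn (fun t => D 2 u t - q.derivative.derivative.eval t)
      (Icc (x i) (x (i + 1))) :=
    ((continuousOn_D hu (k := 2) (by norm_num)).mono hsub).sub
      q.derivative.derivative.continuous.continuousOn
  have c3 := (continuousOn_D hu (k := 3) (by norm_num)).mono hsub
  have c4 := (continuousOn_D hu (k := 4) le_rfl).mono hsub
  have d0 : ∀ t ∈ Ioo (x i) (x (i + 1)), HasDerivAt (fun s => u s - g s)
      (D 1 (fun s => u s - g s) t) t := fun t ht => hzH.hasDerivAt (hosub ht)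
  have hz : ∀ j ≤ m, u (x j) - g (x j) = 0 ∧ D 1 (fun s => u s - g s) (x j) = 0 := by
    intro j hj
    rw [hD1 _ (hx.mem_Icc hj), (hint j hj).1, (hint j hj).2]
    simp
  obtain ⟨hl, hl'⟩ := hz i hi.le
  obtain ⟨hr, hr'⟩ := hz (i + 1) hi
  rw [hD2]
  refine ⟨?_, ?_, ?_⟩
  · refine integral_sq_second_le_fourth hlt c0 c1 c2 (c3.sub continuousOn_const) c4 d0 hd1 hd2
      (fun t ht => ?_) hl hr hl' hr'
    exact (hasDerivAt_D hu (k := 3) (by norm_num) (hosub ht)).sub_const c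
  · exact integral_sq_second_le_third hlt c c0 c1 c2 c3 d0 hd1 hd2 hl hr hl' hr'
  · exact integral_sq_le_of_eq_zero_left hlt.le c1 c2 hd1 hl'

/-- Global error bounds for Hermite interpolation, from pointwise domination of the weighted higher
derivatives in each cell. -/
lemma hermite_error (hx : IsPartition x m) (hu : ContDiffOn ℝ (4 : ℕ) u (Icc 0 1))
    (hg : IsCubicSpline x m g)
    (hint : ∀ i ≤ m, g (x i) = u (x i) ∧ D 1 g (x i) = D 1 u (x i)) {ε : ℝ} {G : ℝ → ℝ}
    (hG : ContinuousOn G (Icc 0 1))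
    (h2 : ∀ i < m, ∀ t ∈ Icc (x i) (x (i + 1)),
      ε ^ 2 * ((x (i + 1) - x i) ^ 4 * D 4 u t ^ 2) ≤ G t)
    (h1 : (∀ i < m, ∀ t ∈ Icc (x i) (x (i + 1)), (x (i + 1) - x i) ^ 6 * D 4 u t ^ 2 ≤ G t) ∨
      ∀ i < m, ∀ t ∈ Icc (x i) (x (i + 1)), (x (i + 1) - x i) ^ 4 * D 3 u t ^ 2 ≤ G t) :
    ε ^ 2 * (∫ t in (0 : ℝ)..1, D 2 (fun s => u s - g s) t ^ 2) ≤ ∫ t in (0 : ℝ)..1, G t ∧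
    ∫ t in (0 : ℝ)..1, D 1 (fun s => u s - g s) t ^ 2 ≤ ∫ t in (0 : ℝ)..1, G t := by
  have hzH : IsH2 (fun s => u s - g s) :=
    (IsH2.of_contDiffOn (by norm_num) hu).sub (hg.isH2 hx)
  have hGi : Integrable G unitMeasure := integrable_of_memLp (memLp_of_continuousOn hG)
  have mono : ∀ i < m, ∀ k ≤ 4, ∀ r : ℝ,
      (∀ t ∈ Icc (x i) (x (i + 1)), r * D k u t ^ 2 ≤ G t) →
      r * (∫ t in x i..x (i + 1), D k u t ^ 2) ≤ ∫ t in x i..x (i + 1), G t := by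
    intro i hi k hk r h
    rw [← intervalIntegral.integral_const_mul]
    have hc := (continuousOn_D hu hk).mono (hx.cell_subset hi)
    exact intervalIntegral.integral_mono_on (hx.lt i hi).le
      ((continuousOn_const.mul (hc.pow 2)).intervalIntegrable_of_Icc (hx.lt i hi).le)
      ((hG.mono (hx.cell_subset hi)).intervalIntegrable_of_Icc (hx.lt i hi).le) h
  rw [← sum_integral_cells hx hGi, ← sum_integral_cells hx hzH.integrable_sq_D_two,
    ← sum_integral_cells hx hzH.integrable_sq_D_one, Finset.mul_sum]
  constructor
  · refine Finset.sum_le_sum fun i hi => ?_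
    have hi := Finset.mem_range.1 hi
    obtain ⟨e1, -, -⟩ := hermite_cell_error hx hu hg hint hi
    calc _ ≤ ε ^ 2 * ((x (i + 1) - x i) ^ 4 * ∫ t in x i..x (i + 1), D 4 u t ^ 2) := by gcongr
      _ = ε ^ 2 * (x (i + 1) - x i) ^ 4 * ∫ t in x i..x (i + 1), D 4 u t ^ 2 := by ring
      _ ≤ _ := mono i hi 4 le_rfl _ fun t ht => by rw [mul_assoc]; exact h2 i hi t ht
  · refine Finset.sum_le_sum fun i hi => ?_
    have hi := Finset.mem_range.1 hi
    obtain ⟨e1, e2, e3⟩ := hermite_cell_error hx hu hg hint hi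
    -- The two alternatives correspond to `‖z'‖ ≤ ℓ³‖u''''‖` and `‖z'‖ ≤ ℓ²‖u'''‖`; the hinged case
    -- uses the first, the clamped case the second.
    rcases h1 with h1 | h1
    · calc _ ≤ _ := e3
        _ ≤ (x (i + 1) - x i) ^ 2 *
            ((x (i + 1) - x i) ^ 4 * ∫ t in x i..x (i + 1), D 4 u t ^ 2) := by gcongr
        _ = (x (i + 1) - x i) ^ 6 * ∫ t in x i..x (i + 1), D 4 u t ^ 2 := by ring
        _ ≤ _ := mono i hi 4 le_rfl _ (h1 i hi)
    · calc _ ≤ _ := e3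
        _ ≤ (x (i + 1) - x i) ^ 2 *
            ((x (i + 1) - x i) ^ 2 * ∫ t in x i..x (i + 1), D 3 u t ^ 2) := by gcongr
        _ = (x (i + 1) - x i) ^ 4 * ∫ t in x i..x (i + 1), D 3 u t ^ 2 := by ring
        _ ≤ _ := mono i hi 3 (by norm_num) _ (h1 i hi)

end Hermite

/-! ### The layer-adapted mesh -/

section Mesh

variable {τ α H : ℝ} {n N : ℕ}

/-- The signs are forced by the counting identities: `n (α H τ)` and `N H` are positive while `n`
and `N` are nonnegative. -/
lemma IsLayerMesh.pos (h : IsLayerMesh τ α H n N) :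
    0 < H ∧ 0 < α ∧ 0 < α * H * τ ∧ 0 < N := by
  have h1 : 0 < (n : ℝ) * (α * H * τ) := h.fine.symm ▸ h.tau_pos
  have h2 : 0 < (N : ℝ) * H := by rw [h.coarse]; linarith [h.tau_lt]
  have hh : 0 < α * H * τ := pos_of_mul_pos_right h1 (Nat.cast_nonneg n)
  have hH : 0 < H := pos_of_mul_pos_right h2 (Nat.cast_nonneg N)
  have hN : 0 < (N : ℝ) := pos_of_mul_pos_left h2 hH.le
  have hα : 0 < α := pos_of_mul_pos_left (pos_of_mul_pos_left hh h.tau_pos.le) hH.le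
  exact ⟨hH, hα, hh, by exact_mod_cast hN⟩

lemma meshPoint_of_le {i : ℕ} (hi : i ≤ n) : meshPoint τ α H n N i = i * (α * H * τ) :=
  if_pos hi

/-- The formula of the fine part is also valid in coarse form at the seam `i = n`, by `fine`;
`coarse` does the same at `i = n + N` in the next lemma. -/
lemma IsLayerMesh.meshPoint_coarse (h : IsLayerMesh τ α H n N) {i : ℕ} (h1 : n ≤ i)
    (h2 : i ≤ n + N) : meshPoint τ α H n N i = τ + ((i : ℝ) - n) * H := by
  rcases h1.eq_or_lt with rfl | h1
  · rw [meshPoint_of_le le_rfl, h.fine]; ring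
  · rw [meshPoint, if_neg (by omega), if_pos h2]

lemma IsLayerMesh.meshPoint_right (h : IsLayerMesh τ α H n N) {i : ℕ} (h1 : n + N ≤ i) :
    meshPoint τ α H n N i = 1 - τ + ((i : ℝ) - n - N) * (α * H * τ) := by
  rcases h1.eq_or_lt with rfl | h1
  · rw [h.meshPoint_coarse (Nat.le_add_right n N) le_rfl]
    push_cast
    linarith [h.coarse]
  · rw [meshPoint, if_neg (by omega), if_neg (by omega)]

/-- Cells of length `H` come with their location, since there the layers must be small; for the fine
length no location is needed. -/
lemma IsLayerMesh.cell (h : IsLayerMesh τ α H n N) (i : ℕ) :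
    meshPoint τ α H n N (i + 1) - meshPoint τ α H n N i = α * H * τ ∨
    (meshPoint τ α H n N (i + 1) - meshPoint τ α H n N i = H ∧
      Icc (meshPoint τ α H n N i) (meshPoint τ α H n N (i + 1)) ⊆ Icc τ (1 - τ)) := by
  obtain ⟨hH, -, -, -⟩ := h.pos
  by_cases h1 : i < n
  · left
    rw [meshPoint_of_le h1.le, meshPoint_of_le h1]
    push_cast
    ring
  by_cases h2 : i < n + N
  · right
    rw [h.meshPoint_coarse (not_lt.1 h1) h2.le, h.meshPoint_coarse (by omega) h2]
    push_cast
    refine ⟨by ring, Icc_subset_Icc ?_ ?_⟩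
    · have : (n : ℝ) ≤ i := by exact_mod_cast not_lt.1 h1
      nlinarith
    · have : (i : ℝ) + 1 ≤ n + N := by exact_mod_cast h2
      nlinarith [h.coarse]
  · left
    rw [h.meshPoint_right (not_lt.1 h2), h.meshPoint_right (by omega)]
    push_cast
    ring

lemma IsLayerMesh.isPartition (h : IsLayerMesh τ α H n N) :
    IsPartition (meshPoint τ α H n N) (2 * n + N) where
  zero := by simp [meshPoint_of_le]
  one := by
    rw [h.meshPoint_right (by omega)]
    push_cast
    linarith [h.fine]
  lt := by
    intro i _
    obtain ⟨hH, -, hh, -⟩ := h.pos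
    rcases h.cell i with hc | ⟨hc, -⟩ <;> linarith

lemma IsSpline.isCubicSpline {v : ℝ → ℝ} (hv : IsSpline τ α H n N v) :
    IsCubicSpline (meshPoint τ α H n N) (2 * n + N) v := ⟨hv.smooth, hv.cubic⟩

lemma IsCubicSpline.isSpline {v : ℝ → ℝ}
    (hv : IsCubicSpline (meshPoint τ α H n N) (2 * n + N) v) : IsSpline τ α H n N v :=
  ⟨hv.smooth, hv.cubic⟩

lemma isCubicSpline_zero (x : ℕ → ℝ) (m : ℕ) : IsCubicSpline x m (fun _ => 0) :=
  ⟨contDiffOn_const, fun _ _ => ⟨0, by simp, fun _ _ => by simp⟩⟩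

lemma isSplineSpace_hinged (h : IsLayerMesh τ α H n N) :
    IsSplineSpace (meshPoint τ α H n N) (2 * n + N) (hingedSpace τ α H n N) where
  spline := fun _ hv => hv.1.isCubicSpline
  left := fun _ hv => hv.2.1
  right := fun _ hv => hv.2.2
  zero := ⟨(isCubicSpline_zero _ _).isSpline, rfl, rfl⟩
  lincomb := fun v hv w hw r s =>
    ⟨(hv.1.isCubicSpline.lincomb hw.1.isCubicSpline r s).isSpline,
      by simp [hv.2.1, hw.2.1], by simp [hv.2.2, hw.2.2]⟩
  congr := fun v hv w hwv =>
    ⟨(hv.1.isCubicSpline.congr h.isPartition hwv).isSpline,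
      (hwv (left_mem_Icc.2 zero_le_one)).trans hv.2.1,
      (hwv (right_mem_Icc.2 zero_le_one)).trans hv.2.2⟩

lemma isSplineSpace_clamped (h : IsLayerMesh τ α H n N) :
    IsSplineSpace (meshPoint τ α H n N) (2 * n + N) (clampedSpace τ α H n N) where
  spline := fun _ hv => hv.1.isCubicSpline
  left := fun _ hv => hv.2.1
  right := fun _ hv => hv.2.2.2.1
  zero := by
    have h0 : ∀ t ∈ Icc (0 : ℝ) 1, D 1 (fun _ => 0) t = 0 := fun t ht =>
      D_one_of_hasDerivWithinAt ht (hasDerivWithinAt_const t _ 0)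
    exact ⟨(isCubicSpline_zero _ _).isSpline, rfl, h0 0 (left_mem_Icc.2 zero_le_one), rfl,
      h0 1 (right_mem_Icc.2 zero_le_one)⟩
  lincomb := fun v hv w hw r s => by
    have hvH := hv.1.isCubicSpline.isH2 h.isPartition
    have hwH := hw.1.isCubicSpline.isH2 h.isPartition
    obtain ⟨hv0, hv0', hv1, hv1'⟩ := hv.2
    obtain ⟨hw0, hw0', hw1, hw1'⟩ := hw.2
    refine ⟨(hv.1.isCubicSpline.lincomb hw.1.isCubicSpline r s).isSpline,
      by simp [hv0, hw0], ?_, by simp [hv1, hw1], ?_⟩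
    · rw [hvH.D_one_lincomb hwH r s (left_mem_Icc.2 zero_le_one), hv0', hw0']; ring
    · rw [hvH.D_one_lincomb hwH r s (right_mem_Icc.2 zero_le_one), hv1', hw1']; ring
  congr := fun v hv w hwv => by
    obtain ⟨hv0, hv0', hv1, hv1'⟩ := hv.2
    have m0 : (0 : ℝ) ∈ Icc (0 : ℝ) 1 := left_mem_Icc.2 zero_le_one
    have m1 : (1 : ℝ) ∈ Icc (0 : ℝ) 1 := right_mem_Icc.2 zero_le_one
    exact ⟨(hv.1.isCubicSpline.congr h.isPartition hwv).isSpline, (hwv m0).trans hv0,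
      (D_congr 1 hwv m0).trans hv0', (hwv m1).trans hv1, (D_congr 1 hwv m1).trans hv1'⟩

end Mesh

/-! ### The layer function -/

/-- The squared boundary layers at both end points. -/
noncomputable def layer (ε t : ℝ) : ℝ := Real.exp (-t / ε) ^ 2 + Real.exp (-(1 - t) / ε) ^ 2

lemma layer_nonneg (ε t : ℝ) : 0 ≤ layer ε t := by unfold layer; positivity

lemma continuous_layer (ε : ℝ) : Continuous (layer ε) := by unfold layer; fun_prop

lemma layer_le {ε τ t : ℝ} (hε : 0 < ε) (ht : t ∈ Icc τ (1 - τ)) :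
    layer ε t ≤ 2 * Real.exp (-(2 * τ / ε)) := by
  have h : ∀ s : ℝ, τ ≤ s → Real.exp (-s / ε) ^ 2 ≤ Real.exp (-(2 * τ / ε)) := by
    intro s hs
    rw [← Real.exp_nat_mul]
    refine Real.exp_le_exp.2 ?_
    have : τ / ε ≤ s / ε := by gcongr
    push_cast
    have e1 : 2 * (-s / ε) = -(2 * (s / ε)) := by ring
    have e2 : 2 * τ / ε = 2 * (τ / ε) := by ring
    rw [e1, e2]
    linarith
  have h1 := h t ht.1
  have h2 := h (1 - t) (by linarith [ht.2])
  unfold layer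
  linarith

/-- An explicit primitive shows that `layer ε` integrates to `ε (1 - e^{-2/ε}) ≤ ε`, so `ε⁻¹` is the
largest weight order that stays uniformly integrable. -/
lemma integral_layer_le {ε : ℝ} (hε : 0 < ε) (B : ℝ) (hB : 0 ≤ B) :
    ∫ t in (0 : ℝ)..1, B * (1 + ε⁻¹ * layer ε t) ≤ 2 * B := by
  have hd : ∀ t : ℝ, HasDerivAt
      (fun t => B * (t + (-(1 / 2) * Real.exp (-t / ε) ^ 2
        + 1 / 2 * Real.exp (-(1 - t) / ε) ^ 2)))
      (B * (1 + ε⁻¹ * layer ε t)) t := by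
    intro t
    have e1 : HasDerivAt (fun t : ℝ => Real.exp (-t / ε)) (Real.exp (-t / ε) * (-1 / ε)) t :=
      (((hasDerivAt_id t).neg).div_const ε).exp
    have e2 : HasDerivAt (fun t : ℝ => Real.exp (-(1 - t) / ε))
        (Real.exp (-(1 - t) / ε) * (-(-1) / ε)) t :=
      ((((hasDerivAt_id t).const_sub 1).neg).div_const ε).exp
    refine ((((hasDerivAt_id t).add (((e1.pow 2).const_mul (-(1 / 2))).add
      ((e2.pow 2).const_mul (1 / 2)))).const_mul B)).congr_deriv ?_
    simp only [layer]
    field_simp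
    ring
  have hc : Continuous fun t => B * (1 + ε⁻¹ * layer ε t) :=
    continuous_const.mul (continuous_const.add (continuous_const.mul (continuous_layer ε)))
  rw [intervalIntegral.integral_eq_sub_of_hasDerivAt (fun t _ => hd t)
    (hc.intervalIntegrable 0 1), ← mul_sub, mul_comm 2 B]
  refine mul_le_mul_of_nonneg_left ?_ hB
  have h1 := sq_nonneg (Real.exp (-1 / ε))
  norm_num
  linarith

/-- One term of the exponential series suffices. Both transition points satisfy `τ / ε = 1 / σ` in
the parameter `σ` used below, so this makes the layers on the coarse part smaller than any chosen
power of `σ`. -/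
lemma exp_neg_two_div_le {σ : ℝ} (hσ : 0 < σ) (k : ℕ) :
    2 * Real.exp (-(2 / σ)) ≤ 2 * k.factorial * σ ^ k := by
  have h := Real.pow_div_factorial_le_exp (2 / σ) (by positivity) k
  have h1 : (1 / σ) ^ k ≤ (2 / σ) ^ k := by gcongr; norm_num
  have hf : (0 : ℝ) < k.factorial := by exact_mod_cast k.factorial_pos
  rw [div_le_iff₀ hf] at h
  rw [Real.exp_neg, mul_assoc]
  refine mul_le_mul_of_nonneg_left ?_ zero_le_two
  rw [inv_le_iff_one_le_mul₀ (Real.exp_pos _)]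
  have h2 : 1 / σ ^ k ≤ Real.exp (2 / σ) * k.factorial := by
    rw [← one_div_pow]; exact h1.trans h
  rw [div_le_iff₀ (by positivity)] at h2
  linarith

lemma HasDecomposition.sq_D_le {p : ℕ} {ε K : ℝ} {u : ℝ → ℝ} (h : HasDecomposition p ε K u)
    {k : ℕ} (hk : k ≤ 4) {t : ℝ} (ht : t ∈ Icc (0 : ℝ) 1) :
    D k u t ^ 2 ≤ 3 * K ^ 2 * (1 + (ε ^ ((p : ℤ) - (k : ℤ))) ^ 2 * layer ε t) := by
  obtain ⟨S, E₀, E₁, hS, hE₀, hE₁, hu, hb⟩ := h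
  have hcd : ∀ {F : ℝ → ℝ}, ContDiffOn ℝ 4 F (Icc 0 1) → ContDiffWithinAt ℝ k F (Icc 0 1) t :=
    fun hF => (hF t ht).of_le (by exact_mod_cast hk)
  have hD : D k u t = D k S t + D k E₀ t + D k E₁ t := by
    rw [D_congr k (w := S + E₀ + E₁) (fun s hs => by simp [hu s hs]) ht]
    simp only [D]
    rw [iteratedDerivWithin_add (f := S + E₀) ht uniqueDiffOn_unit ((hcd hS).add (hcd hE₀)) (hcd hE₁),
      iteratedDerivWithin_add ht uniqueDiffOn_unit (hcd hS) (hcd hE₀)]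
  obtain ⟨h1, h2, h3⟩ := hb k hk t ht
  have s1 := sq_le_sq' (abs_le.1 h1).1 (abs_le.1 h1).2
  have s2 := sq_le_sq' (abs_le.1 h2).1 (abs_le.1 h2).2
  have s3 := sq_le_sq' (abs_le.1 h3).1 (abs_le.1 h3).2
  have h4 : (D k S t + D k E₀ t + D k E₁ t) ^ 2
      ≤ 3 * (D k S t ^ 2 + D k E₀ t ^ 2 + D k E₁ t ^ 2) := by
    nlinarith [sq_nonneg (D k S t - D k E₀ t), sq_nonneg (D k S t - D k E₁ t),
      sq_nonneg (D k E₀ t - D k E₁ t)]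
  rw [hD]
  refine h4.trans ?_
  unfold layer
  linarith

/-! ### Error bounds on the layer-adapted mesh -/

/-- For fine cells: smooth and layer parts are compared separately, the layer being kept for
integration. -/
lemma mul_le_of_layer {W κ ρ φ B s d : ℝ} (hW : 0 ≤ W) (hφ : 0 ≤ φ) (hd : d ≤ κ * (1 + ρ * φ))
    (h1 : W * κ ≤ B) (h2 : W * κ * ρ ≤ B * s) : W * d ≤ B * (1 + s * φ) := by
  have := mul_le_mul_of_nonneg_left hd hW
  have := mul_le_mul_of_nonneg_right h2 hφ
  linarith

/-- For coarse cells: the amplified layer is already bounded by a constant `F` and joins the smooth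
part. -/
lemma mul_le_of_layer_le {W κ ρ φ B s d F : ℝ} (hW : 0 ≤ W) (hκ : 0 ≤ κ) (hφ : 0 ≤ φ)
    (hs : 0 ≤ s) (hB : 0 ≤ B)
    (hd : d ≤ κ * (1 + ρ * φ)) (h1 : ρ * φ ≤ F) (h2 : W * (κ * (1 + F)) ≤ B) :
    W * d ≤ B * (1 + s * φ) := by
  have h3 : W * d ≤ W * (κ * (1 + F)) := by
    refine mul_le_mul_of_nonneg_left (hd.trans ?_) hW
    gcongr
  have h4 : 0 ≤ B * (s * φ) := by positivity
  linarith

/-- Quasi-optimality combined with Hermite interpolation on a layer-adapted mesh: it is enough to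
dominate the weighted higher derivatives in every cell. -/
lemma galerkinErrorLE_of_cells {τ α H ε γ M B A : ℝ} {n N : ℕ} {a b c f u : ℝ → ℝ}
    {V : Set (ℝ → ℝ)} (hm : IsLayerMesh τ α H n N)
    (hV : IsSplineSpace (meshPoint τ α H n N) (2 * n + N) V) (hγ : 0 < γ) (hε : 0 < ε)
    (hc : CoeffBound M a b c) (hell : IsElliptic γ a b c) (hs : IsSolution ε a b c f u)
    (hu0 : u 0 = 0) (hu1 : u 1 = 0)
    (hV0 : ∀ v ∈ V, D 2 u 0 * D 1 v 0 = 0) (hV1 : ∀ v ∈ V, D 2 u 1 * D 1 v 1 = 0)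
    (hint : ∀ g, IsCubicSpline (meshPoint τ α H n N) (2 * n + N) g → g 0 = u 0 → g 1 = u 1 →
      D 1 g 0 = D 1 u 0 → D 1 g 1 = D 1 u 1 → g ∈ V)
    (hB : 0 ≤ B) (hA : 0 ≤ A) (hBA : 2 * B ≤ A ^ 2)
    (h2 : ∀ ℓ : ℝ, ∀ t ∈ Icc (0 : ℝ) 1, (ℓ = α * H * τ ∨ (ℓ = H ∧ t ∈ Icc τ (1 - τ))) →
      ε ^ 2 * (ℓ ^ 4 * D 4 u t ^ 2) ≤ B * (1 + ε⁻¹ * layer ε t))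
    (h1 : (∀ ℓ : ℝ, ∀ t ∈ Icc (0 : ℝ) 1, (ℓ = α * H * τ ∨ (ℓ = H ∧ t ∈ Icc τ (1 - τ))) →
        ℓ ^ 6 * D 4 u t ^ 2 ≤ B * (1 + ε⁻¹ * layer ε t)) ∨
      ∀ ℓ : ℝ, ∀ t ∈ Icc (0 : ℝ) 1, (ℓ = α * H * τ ∨ (ℓ = H ∧ t ∈ Icc τ (1 - τ))) →
        ℓ ^ 4 * D 3 u t ^ 2 ≤ B * (1 + ε⁻¹ * layer ε t)) :
    GalerkinErrorLE ε a b c f u V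
      (Real.sqrt (1 + 12 * M ^ 2 / γ) * (1 + 1 / Real.sqrt γ) * A) := by
  have hx := hm.isPartition
  have hu4 : ContDiffOn ℝ (4 : ℕ) u (Icc 0 1) := by exact_mod_cast hs.smooth
  have hu : IsH2 u := IsH2.of_contDiffOn (by norm_num) hu4
  obtain ⟨g, hg, hgi⟩ := exists_hermite hx (fun i => u (meshPoint τ α H n N i))
    (fun i => D 1 u (meshPoint τ α H n N i))
  have hl := hgi 0 (Nat.zero_le _)
  have hr := hgi (2 * n + N) le_rfl
  rw [hx.zero] at hl
  rw [hx.one] at hr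
  have hcell : ∀ i < 2 * n + N, ∀ t ∈ Icc (meshPoint τ α H n N i) (meshPoint τ α H n N (i + 1)),
      t ∈ Icc (0 : ℝ) 1 ∧ (meshPoint τ α H n N (i + 1) - meshPoint τ α H n N i = α * H * τ ∨
        (meshPoint τ α H n N (i + 1) - meshPoint τ α H n N i = H ∧ t ∈ Icc τ (1 - τ))) :=
    fun i hi t ht => ⟨hx.cell_subset hi ht,
      (hm.cell i).imp_right fun h => ⟨h.1, h.2 ht⟩⟩
  have hG : Continuous fun t => B * (1 + ε⁻¹ * layer ε t) :=
    continuous_const.mul (continuous_const.add (continuous_const.mul (continuous_layer ε)))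
  obtain ⟨e2, e1⟩ := hermite_error hx hu4 hg hgi (ε := ε) hG.continuousOn
    (fun i hi t ht => h2 _ t (hcell i hi t ht).1 (hcell i hi t ht).2)
    (h1.imp (fun h i hi t ht => h _ t (hcell i hi t ht).1 (hcell i hi t ht).2)
      (fun h i hi t ht => h _ t (hcell i hi t ht).1 (hcell i hi t ht).2))
  have hGA := (integral_layer_le hε B hB).trans hBA
  exact hV.galerkinErrorLE hx hγ hε hc hell hu hu0 hu1
    (fun v hv => hs.weak hc (hV.isH2 hx hv) (hV.left v hv) (hV.right v hv) (hV0 v hv) (hV1 v hv))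
    (hint g hg hl.1 hr.1 hl.2 hr.2) hA (e2.trans hGA) (e1.trans hGA)

/-- Here `σ = ε^{1/2} = τ`, which turns all fractional powers into natural ones. -/
lemma hinged_error {γ M K α₀ σ α H : ℝ} {n N : ℕ} {a b c f u : ℝ → ℝ} (hγ : 0 < γ)
    (hσ : 0 < σ) (hα : α ≤ α₀) (hm : IsLayerMesh σ α H n N)
    (hc : CoeffBound M a b c) (hell : IsElliptic γ a b c)
    (hs : IsSolution (σ ^ 2) a b c f u) (hbc : HingedBC u)
    (hdec : HasDecomposition 2 (σ ^ 2) K u) :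
    GalerkinErrorLE (σ ^ 2) a b c f u (hingedSpace σ α H n N)
      (Real.sqrt (1 + 12 * M ^ 2 / γ) * (1 + 1 / Real.sqrt γ) *
        (Real.sqrt (6 * K ^ 2 * (1 + 2 * Nat.factorial 8)) * (1 + |α₀|) ^ 3
          * (σ * H ^ 2 + H ^ 3))) := by
  obtain ⟨hH, hα0, -, -⟩ := hm.pos
  obtain ⟨hu0, hu0'', hu1, hu1''⟩ := hbc
  have hσ1 : σ ≤ 1 := by linarith [hm.tau_lt]
  -- The exponent `8` cancels the squared layer amplitude `(ε^{2-4})² = σ⁻⁸` of the fourth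
  -- derivative.
  set F : ℝ := 2 * Nat.factorial 8 with hF
  have hF0 : 0 ≤ F := by positivity
  set κ := 3 * K ^ 2 with hκ
  have hκ0 : 0 ≤ κ := by positivity
  set m := 1 + |α₀| with hm'
  have hm1 : 1 ≤ m := by simp [hm']
  have hαm : α ≤ m := by linarith [le_abs_self α₀]
  set B := κ * (1 + F) * (m ^ 3 * (σ * H ^ 2 + H ^ 3)) ^ 2 with hB
  have hκF : κ ≤ κ * (1 + F) := by nlinarith
  have hsq1 : m ^ 6 * (σ ^ 2 * H ^ 4) ≤ (m ^ 3 * (σ * H ^ 2 + H ^ 3)) ^ 2 := by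
    have : 0 ≤ m ^ 6 * (2 * σ * H ^ 5 + H ^ 6) := by positivity
    linarith
  have hsq2 : m ^ 6 * H ^ 6 ≤ (m ^ 3 * (σ * H ^ 2 + H ^ 3)) ^ 2 := by
    have : 0 ≤ m ^ 6 * (2 * σ * H ^ 5 + σ ^ 2 * H ^ 4) := by positivity
    linarith
  have hB1 : κ * (1 + F) * (m ^ 6 * (σ ^ 2 * H ^ 4)) ≤ B := by
    rw [hB]; exact mul_le_mul_of_nonneg_left hsq1 (by positivity)
  have hB2 : κ * (1 + F) * (m ^ 6 * H ^ 6) ≤ B := by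
    rw [hB]; exact mul_le_mul_of_nonneg_left hsq2 (by positivity)
  have hB0 : 0 ≤ B := by positivity
  have hα6 : α ^ 6 ≤ m ^ 6 := by gcongr
  -- Since `m ≥ 1`, the single factor `m ^ 6` covers `α ^ 4`, `α ^ 6` and the coarse cells, which
  -- carry no `α`.
  have hα4 : α ^ 4 ≤ m ^ 6 :=
    (pow_le_pow_left₀ hα0.le hαm 4).trans (pow_le_pow_right₀ hm1 (by norm_num))
  have hm6 : 1 ≤ m ^ 6 := one_le_pow₀ hm1
  have hp1 : ∀ k : ℕ, σ ^ k ≤ 1 := fun k => pow_le_one₀ hσ.le hσ1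
  have hD : ∀ t ∈ Icc (0 : ℝ) 1, D 4 u t ^ 2 ≤ κ * (1 + (σ ^ 8)⁻¹ * layer (σ ^ 2) t) := by
    intro t ht
    have h := hdec.sq_D_le (k := 4) le_rfl ht
    have e : (((σ ^ 2) ^ (((2 : ℕ) : ℤ) - ((4 : ℕ) : ℤ))) : ℝ) ^ 2 = (σ ^ 8)⁻¹ := by
      have : (((2 : ℕ) : ℤ) - ((4 : ℕ) : ℤ)) = -((2 : ℕ) : ℤ) := by norm_num
      rw [this, zpow_neg, zpow_natCast]
      field_simp
    rwa [e] at h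
  have hcoarse : ∀ t ∈ Icc σ (1 - σ), (σ ^ 8)⁻¹ * layer (σ ^ 2) t ≤ F := by
    intro t ht
    have h := layer_le (ε := σ ^ 2) (by positivity) ht
    have e : 2 * σ / σ ^ 2 = 2 / σ := by field_simp
    rw [e] at h
    have := h.trans (exp_neg_two_div_le hσ 8)
    rw [inv_mul_le_iff₀ (by positivity)]
    linarith
  refine galerkinErrorLE_of_cells hm (isSplineSpace_hinged hm) hγ (by positivity) hc hell hs hu0 hu1
    (fun v _ => by simp [hu0'']) (fun v _ => by simp [hu1''])
    (fun g hg h0 h1 _ _ => ⟨hg.isSpline, h0.trans hu0, h1.trans hu1⟩) hB0 (by positivity) ?_ ?_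
    (Or.inl ?_)
  · rw [mul_assoc, mul_pow, Real.sq_sqrt (by positivity), hB]
    exact le_of_eq (by ring)
  · rintro ℓ t ht (rfl | ⟨rfl, htc⟩)
    · rw [← mul_assoc]
      refine mul_le_of_layer (by positivity) (layer_nonneg _ _) (hD t ht) ?_ ?_
      · calc (σ ^ 2) ^ 2 * (α * H * σ) ^ 4 * κ = κ * (α ^ 4 * (σ ^ 2 * H ^ 4)) * σ ^ 6 := by ring
          _ ≤ κ * (α ^ 4 * (σ ^ 2 * H ^ 4)) * 1 := by gcongr; exact hp1 6
          _ ≤ κ * (1 + F) * (m ^ 6 * (σ ^ 2 * H ^ 4)) := by rw [mul_one]; gcongr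
          _ ≤ B := hB1
      · calc (σ ^ 2) ^ 2 * (α * H * σ) ^ 4 * κ * (σ ^ 8)⁻¹
            = κ * (α ^ 4 * (σ ^ 2 * H ^ 4)) * (σ ^ 2)⁻¹ := by field_simp
          _ ≤ κ * (1 + F) * (m ^ 6 * (σ ^ 2 * H ^ 4)) * (σ ^ 2)⁻¹ := by gcongr
          _ ≤ B * (σ ^ 2)⁻¹ := by gcongr
    · rw [← mul_assoc]
      refine mul_le_of_layer_le (by positivity) hκ0 (layer_nonneg _ _) (by positivity) hB0 (hD t ht)
        (hcoarse t htc) ?_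
      calc (σ ^ 2) ^ 2 * ℓ ^ 4 * (κ * (1 + F)) = κ * (1 + F) * (1 * (σ ^ 2 * ℓ ^ 4)) * σ ^ 2 := by
            ring
        _ ≤ κ * (1 + F) * (1 * (σ ^ 2 * ℓ ^ 4)) * 1 := by gcongr; exact hp1 2
        _ ≤ κ * (1 + F) * (m ^ 6 * (σ ^ 2 * ℓ ^ 4)) := by rw [mul_one]; gcongr
        _ ≤ B := hB1
  · rintro ℓ t ht (rfl | ⟨rfl, htc⟩)
    · refine mul_le_of_layer (by positivity) (layer_nonneg _ _) (hD t ht) ?_ ?_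
      · calc (α * H * σ) ^ 6 * κ = κ * (α ^ 6 * H ^ 6) * σ ^ 6 := by ring
          _ ≤ κ * (α ^ 6 * H ^ 6) * 1 := by gcongr; exact hp1 6
          _ ≤ κ * (1 + F) * (m ^ 6 * H ^ 6) := by rw [mul_one]; gcongr
          _ ≤ B := hB2
      · calc (α * H * σ) ^ 6 * κ * (σ ^ 8)⁻¹
            = κ * (α ^ 6 * H ^ 6) * (σ ^ 2)⁻¹ := by field_simp
          _ ≤ κ * (1 + F) * (m ^ 6 * H ^ 6) * (σ ^ 2)⁻¹ := by gcongr
          _ ≤ B * (σ ^ 2)⁻¹ := by gcongr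
    · refine mul_le_of_layer_le (by positivity) hκ0 (layer_nonneg _ _) (by positivity) hB0 (hD t ht)
        (hcoarse t htc) ?_
      calc ℓ ^ 6 * (κ * (1 + F)) = κ * (1 + F) * (1 * ℓ ^ 6) := by ring
        _ ≤ κ * (1 + F) * (m ^ 6 * ℓ ^ 6) := by gcongr
        _ ≤ B := hB2

/-- Here `σ = ε^{1/4}` and `τ = σ ^ 3`. The `|·|₁` part goes through the third derivative, whose
squared layer amplitude is only `σ⁻¹⁶`. -/
lemma clamped_error {γ M K α₀ σ α H : ℝ} {n N : ℕ} {a b c f u : ℝ → ℝ} (hγ : 0 < γ)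
    (hσ : 0 < σ) (hα : α ≤ α₀) (hm : IsLayerMesh (σ ^ 3) α H n N)
    (hc : CoeffBound M a b c) (hell : IsElliptic γ a b c)
    (hs : IsSolution (σ ^ 4) a b c f u) (hbc : ClampedBC u)
    (hdec : HasDecomposition 1 (σ ^ 4) K u) :
    GalerkinErrorLE (σ ^ 4) a b c f u (clampedSpace (σ ^ 3) α H n N)
      (Real.sqrt (1 + 12 * M ^ 2 / γ) * (1 + 1 / Real.sqrt γ) *
        (Real.sqrt (6 * K ^ 2 * (1 + 2 * Nat.factorial 24)) * (1 + |α₀|) ^ 2 * H ^ 2)) := by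
  obtain ⟨hH, hα0, -, -⟩ := hm.pos
  obtain ⟨hu0, hu0', hu1, hu1'⟩ := hbc
  have hσ1 : σ ≤ 1 := by
    by_contra hcon
    have : 1 ≤ σ ^ 3 := one_le_pow₀ (not_le.1 hcon).le
    linarith [hm.tau_lt]
  -- The exponent `24` cancels `(ε^{1-4})² = σ⁻²⁴`; as `σ ≤ 1`, it also serves the third derivative.
  set F : ℝ := 2 * Nat.factorial 24 with hF
  have hF0 : 0 ≤ F := by positivity
  set κ := 3 * K ^ 2 with hκ
  have hκ0 : 0 ≤ κ := by positivity
  set m := 1 + |α₀| with hm'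
  have hm1 : 1 ≤ m := by simp [hm']
  have hαm : α ≤ m := by linarith [le_abs_self α₀]
  set B := κ * (1 + F) * (m ^ 4 * H ^ 4) with hB
  have hκF : κ ≤ κ * (1 + F) := by nlinarith
  have hB0 : 0 ≤ B := by positivity
  have hα4 : α ^ 4 ≤ m ^ 4 := by gcongr
  have hm4 : 1 ≤ m ^ 4 := one_le_pow₀ hm1
  have hαB : κ * (α ^ 4 * H ^ 4) ≤ B := by rw [hB]; gcongr
  have h1B : κ * (1 + F) * (1 * H ^ 4) ≤ B := by rw [hB]; gcongr
  have hp1 : ∀ k : ℕ, σ ^ k ≤ 1 := fun k => pow_le_one₀ hσ.le hσ1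
  have hD4 : ∀ t ∈ Icc (0 : ℝ) 1, D 4 u t ^ 2 ≤ κ * (1 + (σ ^ 24)⁻¹ * layer (σ ^ 4) t) := by
    intro t ht
    have h := hdec.sq_D_le (k := 4) le_rfl ht
    have e : (((σ ^ 4) ^ (((1 : ℕ) : ℤ) - ((4 : ℕ) : ℤ))) : ℝ) ^ 2 = (σ ^ 24)⁻¹ := by
      have : (((1 : ℕ) : ℤ) - ((4 : ℕ) : ℤ)) = -((3 : ℕ) : ℤ) := by norm_num
      rw [this, zpow_neg, zpow_natCast]
      field_simp
    rwa [e] at h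
  have hD3 : ∀ t ∈ Icc (0 : ℝ) 1, D 3 u t ^ 2 ≤ κ * (1 + (σ ^ 16)⁻¹ * layer (σ ^ 4) t) := by
    intro t ht
    have h := hdec.sq_D_le (k := 3) (by norm_num) ht
    have e : (((σ ^ 4) ^ (((1 : ℕ) : ℤ) - ((3 : ℕ) : ℤ))) : ℝ) ^ 2 = (σ ^ 16)⁻¹ := by
      have : (((1 : ℕ) : ℤ) - ((3 : ℕ) : ℤ)) = -((2 : ℕ) : ℤ) := by norm_num
      rw [this, zpow_neg, zpow_natCast]
      field_simp
    rwa [e] at h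
  have hlayer : ∀ t ∈ Icc (σ ^ 3) (1 - σ ^ 3), layer (σ ^ 4) t ≤ F * σ ^ 24 := by
    intro t ht
    have h := layer_le (ε := σ ^ 4) (by positivity) ht
    have e : 2 * σ ^ 3 / σ ^ 4 = 2 / σ := by field_simp
    rw [e] at h
    exact h.trans (exp_neg_two_div_le hσ 24)
  have hc4 : ∀ t ∈ Icc (σ ^ 3) (1 - σ ^ 3), (σ ^ 24)⁻¹ * layer (σ ^ 4) t ≤ F := by
    intro t ht
    rw [inv_mul_le_iff₀ (by positivity)]
    linarith [hlayer t ht]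
  have hc3 : ∀ t ∈ Icc (σ ^ 3) (1 - σ ^ 3), (σ ^ 16)⁻¹ * layer (σ ^ 4) t ≤ F := by
    intro t ht
    rw [inv_mul_le_iff₀ (by positivity)]
    have : F * σ ^ 24 ≤ F * σ ^ 16 :=
      mul_le_mul_of_nonneg_left (pow_le_pow_of_le_one hσ.le hσ1 (by norm_num)) hF0
    linarith [hlayer t ht]
  refine galerkinErrorLE_of_cells hm (isSplineSpace_clamped hm) hγ (by positivity) hc hell hs
    hu0 hu1 (fun v hv => by simp [hv.2.2.1]) (fun v hv => by simp [hv.2.2.2.2])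
    (fun g hg h0 h1 h0' h1' =>
      ⟨hg.isSpline, h0.trans hu0, h0'.trans hu0', h1.trans hu1, h1'.trans hu1'⟩)
    hB0 (by positivity) ?_ ?_ (Or.inr ?_)
  · rw [mul_assoc, mul_pow, Real.sq_sqrt (by positivity), hB]
    exact le_of_eq (by ring)
  · rintro ℓ t ht (rfl | ⟨rfl, htc⟩)
    · rw [← mul_assoc]
      refine mul_le_of_layer (by positivity) (layer_nonneg _ _) (hD4 t ht) ?_ ?_
      · calc (σ ^ 4) ^ 2 * (α * H * σ ^ 3) ^ 4 * κ = κ * (α ^ 4 * H ^ 4) * σ ^ 20 := by ring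
          _ ≤ κ * (α ^ 4 * H ^ 4) * 1 := by gcongr; exact hp1 20
          _ ≤ B := by rwa [mul_one]
      · calc (σ ^ 4) ^ 2 * (α * H * σ ^ 3) ^ 4 * κ * (σ ^ 24)⁻¹
            = κ * (α ^ 4 * H ^ 4) * (σ ^ 4)⁻¹ := by field_simp
          _ ≤ B * (σ ^ 4)⁻¹ := by gcongr
    · rw [← mul_assoc]
      refine mul_le_of_layer_le (by positivity) hκ0 (layer_nonneg _ _) (by positivity) hB0
        (hD4 t ht) (hc4 t htc) ?_
      calc (σ ^ 4) ^ 2 * ℓ ^ 4 * (κ * (1 + F)) = κ * (1 + F) * (1 * ℓ ^ 4) * σ ^ 8 := by ring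
        _ ≤ κ * (1 + F) * (1 * ℓ ^ 4) * 1 := by gcongr; exact hp1 8
        _ ≤ B := by rwa [mul_one]
  · rintro ℓ t ht (rfl | ⟨rfl, htc⟩)
    · refine mul_le_of_layer (by positivity) (layer_nonneg _ _) (hD3 t ht) ?_ ?_
      · calc (α * H * σ ^ 3) ^ 4 * κ = κ * (α ^ 4 * H ^ 4) * σ ^ 12 := by ring
          _ ≤ κ * (α ^ 4 * H ^ 4) * 1 := by gcongr; exact hp1 12
          _ ≤ B := by rwa [mul_one]
      · calc (α * H * σ ^ 3) ^ 4 * κ * (σ ^ 16)⁻¹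
            = κ * (α ^ 4 * H ^ 4) * (σ ^ 4)⁻¹ := by field_simp
          _ ≤ B * (σ ^ 4)⁻¹ := by gcongr
    · refine mul_le_of_layer_le (by positivity) hκ0 (layer_nonneg _ _) (by positivity) hB0
        (hD3 t ht) (hc3 t htc) ?_
      calc ℓ ^ 4 * (κ * (1 + F)) = κ * (1 + F) * (1 * ℓ ^ 4) := by ring
        _ ≤ B := h1B

lemma GalerkinErrorLE.mono {ε B B' : ℝ} {a b c f u : ℝ → ℝ} {V : Set (ℝ → ℝ)}
    (h : GalerkinErrorLE ε a b c f u V B) (hB : B ≤ B') : GalerkinErrorLE ε a b c f u V B' := by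
  obtain ⟨w, h1, h2, h3⟩ := h
  exact ⟨w, h1, h2, h3.trans hB⟩

end LayerFEM

theorem mainTheorem6 (γ M K α₀ : ℝ) (hγ : 0 < γ) :
    (∃ C : ℝ, 0 < C ∧ ∀ (ε α H : ℝ) (n N : ℕ) (a b c f u : ℝ → ℝ),
      0 < ε → α ≤ α₀ → LayerFEM.IsLayerMesh (ε ^ (1 / 2 : ℝ)) α H n N →
      LayerFEM.CoeffBound M a b c → LayerFEM.IsElliptic γ a b c →
      LayerFEM.IsSolution ε a b c f u → LayerFEM.HingedBC u →
      LayerFEM.HasDecomposition 2 ε K u →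
      LayerFEM.GalerkinErrorLE ε a b c f u
        (LayerFEM.hingedSpace (ε ^ (1 / 2 : ℝ)) α H n N)
        (C * (ε ^ (1 / 2 : ℝ) * H ^ 2 + H ^ 3))) ∧
    (∃ C : ℝ, 0 < C ∧ ∀ (ε α H : ℝ) (n N : ℕ) (a b c f u : ℝ → ℝ),
      0 < ε → α ≤ α₀ → LayerFEM.IsLayerMesh (ε ^ (3 / 4 : ℝ)) α H n N →
      LayerFEM.CoeffBound M a b c → LayerFEM.IsElliptic γ a b c →
      LayerFEM.IsSolution ε a b c f u → LayerFEM.ClampedBC u →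
      LayerFEM.HasDecomposition 1 ε K u →
      LayerFEM.GalerkinErrorLE ε a b c f u
        (LayerFEM.clampedSpace (ε ^ (3 / 4 : ℝ)) α H n N)
        (C * H ^ 2)) := by
  constructor
  -- The added `1` keeps the constant positive when `K = 0`.
  · refine ⟨Real.sqrt (1 + 12 * M ^ 2 / γ) * (1 + 1 / Real.sqrt γ) *
      (Real.sqrt (6 * K ^ 2 * (1 + 2 * Nat.factorial 8)) * (1 + |α₀|) ^ 3) + 1, by positivity, ?_⟩
    intro ε α H n N a b c f u hε hα hm hc hell hs hbc hdec
    set σ := ε ^ (1 / 2 : ℝ) with hσ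
    have hσ0 : 0 < σ := Real.rpow_pos_of_pos hε _
    have hεσ : ε = σ ^ 2 := by
      rw [hσ, ← Real.rpow_natCast, ← Real.rpow_mul hε.le]; norm_num
    obtain ⟨hH, -, -, -⟩ := hm.pos
    rw [hεσ] at hs hdec ⊢
    refine (LayerFEM.hinged_error hγ hσ0 hα hm hc hell hs hbc hdec).mono ?_
    have : 0 ≤ σ * H ^ 2 + H ^ 3 := by positivity
    linarith
  · refine ⟨Real.sqrt (1 + 12 * M ^ 2 / γ) * (1 + 1 / Real.sqrt γ) *
      (Real.sqrt (6 * K ^ 2 * (1 + 2 * Nat.factorial 24)) * (1 + |α₀|) ^ 2) + 1, by positivity, ?_⟩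
    intro ε α H n N a b c f u hε hα hm hc hell hs hbc hdec
    -- The fourth root makes both `ε` and `τ` natural powers of `σ`.
    set σ := ε ^ (1 / 4 : ℝ) with hσ
    have hσ0 : 0 < σ := Real.rpow_pos_of_pos hε _
    have hεσ : ε = σ ^ 4 := by
      rw [hσ, ← Real.rpow_natCast, ← Real.rpow_mul hε.le]; norm_num
    have hτ : ε ^ (3 / 4 : ℝ) = σ ^ 3 := by
      rw [hσ, ← Real.rpow_natCast, ← Real.rpow_mul hε.le]; norm_num
    rw [hτ] at hm ⊢
    obtain ⟨hH, -, -, -⟩ := hm.pos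
    rw [hεσ] at hs hdec ⊢
    refine (LayerFEM.clamped_error hγ hσ0 hα hm hc hell hs hbc hdec).mono ?_
    have : 0 ≤ H ^ 2 := by positivity
    linarith
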